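/- Let $p,q\ge 0$ and let $V(\mathbb R)=\mathbb R^{p+q}$ carry the form $Q(v,w)=\sum_{\alpha\le p}v_\alpha w_\alpha-\sum_{\mu>p}v_\mu w_\mu$, with standard basis $e_1,\dots,e_{p+q}$ (indices $\alpha\le p<\mu$). Let $G(\mathbb R)^+$ be the identity component of the orthogonal group of $Q$, $\mathfrak g$ its Lie algebra, $z_0=\langle e_{p+1},\dots,e_{p+q}\rangle$ with inner product $\langle w,w'\rangle=-Q(w,w')$, $\mathrm{pr}\colon V(\mathbb R)\to z_0$ the orthogonal projection, $K$ the stabilizer of $z_0$ in $G(\mathbb R)^+$, with Lie algebra $\mathfrak k$, and $\mathfrak p$ the orthogonal complement of $\mathfrak k$ in $\mathfrak g$. Let $\mathbb D^+=G(\mathbb R)^+/K$ (the space of negative $q$-planes, $gK\leftrightarrow gz_0$) and $E=G(\mathbb R)^+\times_K z_0$, i.e. $[gk,w]=[g,kw]$ for $k\in K$. Forms on $\mathbb D^+$ and on $E$ are identified with basic (horizontal and $K$-invariant) forms on $G(\mathbb R)^+$ and on $G(\mathbb R)^+\times z_0$. For $v\in V(\mathbb R)$ let $s_v\colon\mathbb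 D^+\to E$, $s_v(gz_0)=[g,\mathrm{pr}(g^{-1}v)]$. *Kudla–Millson form.* Let $\omega_{\alpha\mu}\in\mathfrak p^*$ be dual to $X_{\alpha\mu}\in\mathfrak p$, where $X_{\alpha\mu}$ exchanges $e_\alpha$ and $e_\mu$ and kills the other basis vectors. At the base point, $$\varphi_{KM}(v)_e=\frac1{2^q}\prod_{\mu=p+1}^{p+q}\ \sum_{\alpha=1}^p\omega_{\alpha\mu}\otimes\Bigl(x_\alpha-\frac1{2\pi}\frac{\partial}{\partial x_\alpha}\Bigr)\ e^{-\pi\sum_i x_i^2}\Big|_{x=v}\in\textstyle\bigwedge^q\mathfrak p^*,$$ the factors being taken in increasing order of $\mu$, and $\varphi_{KM}(v)$ is its extension to $\mathbb D^+$ with $L_g^*\varphi_{KM}(v)=\varphi_{KM}(g^{-1}v)$ for $g\in G(\mathbb R)^+$. *Mathai–Quillen form.* Let $\theta$ be the $\mathfrak k$-component of the Maurer–Cartan form of $G(\mathbb R)^+$, $\widetilde\theta$ its pullback to $G(\mathbb R)^+\times z_0$, $\widetilde R=d\widetilde\theta+\frac12[\widetilde\theta,\widetilde\theta]$ its curvature,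 $\rho$ the restriction of endomorphisms in $\mathfrak k$ to $z_0$, $\mathbf s(g,w)=w$ the tautological section and $\widetilde\nabla\mathbf s=d\mathbf s+\rho(\widetilde\theta)\mathbf s$. View $\rho(\widetilde R)$ as a form with values in $\bigwedge^2z_0$ by $A\mapsto\sum_{\mu<\nu}\langle Ae_\mu,e_\nu\rangle e_\mu\wedge e_\nu$, and multiply forms with values in $\bigwedge z_0$ by $(\omega\otimes s)\wedge(\eta\otimes t)=(-1)^{\deg s\deg\eta}(\omega\wedge\eta)\otimes(s\wedge t)$. Orient $z_0$ by an orthonormal basis $b_1,\dots,b_q$, let $\int^B(\omega\otimes s)=\langle s,b_1\wedge\dots\wedge b_q\rangle\,\omega$, and $$U_{MQ}=(-1)^{\frac{q(q+1)}2}(2\pi)^{-\frac q2}\int^B\exp\bigl(-2\pi\lVert\mathbf s\rVert^2-2\sqrt\pi\,\widetilde\nabla\mathbf s+\rho(\widetilde R)\bigr).$$ Let $\varepsilon=\pm1$ be the determinant of $(b_1,\dots,b_q)$ with respect to $(e_{p+1},\dots,e_{p+q})$. **Theorem.** Let $\Gamma\subset G(\mathbb R)^+$ be a subgroup, $v\in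 V(\mathbb R)$ and $\Gamma_v$ the stabilizer of $v$ in $\Gamma$. Then $U_{MQ}$ is a smooth $\Gamma_v$-invariant $q$-form on $E$, both $s_v^*U_{MQ}$ and $\varphi_{KM}(v)$ are smooth $\Gamma_v$-invariant $q$-forms on $\mathbb D^+$ (that is, $q$-forms on $\Gamma_v\backslash\mathbb D^+$), and $$\varphi_{KM}(v)=(-1)^q\varepsilon\;2^{-\frac q2}e^{-\pi Q(v,v)}\,s_v^*U_{MQ}.$$ In particular, if $z_0$ is oriented by $(-e_{p+1},\dots,-e_{p+q})$, then $\varphi_{KM}(v)=2^{-\frac q2}e^{-\pi Q(v,v)}\,s_v^*U_{MQ}$. -/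

import Mathlib

open scoped TensorProduct SchwartzMap

namespace KudlaMillson

noncomputable section

/-! ## The quadratic space, the group and its Lie algebra -/

/-- `V(ℝ)` in the coordinates of the orthogonal basis `e₁, …, e_{p+q}`:
`Sum.inl α` indexes the positive basis vectors, `Sum.inr μ` the negative ones. -/
abbrev V (p q : ℕ) : Type := Fin p ⊕ Fin q → ℝ

/-- The negative plane `z₀` spanned by the last `q` basis vectors, in coordinates. -/
abbrev Z (q : ℕ) : Type := Fin q → ℝ

/-- The symmetric bilinear form `Q` of signature `(p, q)`. -/
def form {p q : ℕ} (v w : V p q) : ℝ :=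
  ∑ α, v (Sum.inl α) * w (Sum.inl α) - ∑ μ, v (Sum.inr μ) * w (Sum.inr μ)

/-- The inclusion of `z₀` in `V(ℝ)`. -/
def incl (p q : ℕ) : Z q →ₗ[ℝ] V p q where
  toFun w := Sum.elim 0 w
  map_add' w w' := by ext (i | i) <;> simp
  map_smul' c w := by ext (i | i) <;> simp

/-- The orthogonal projection of `V(ℝ)` onto `z₀`. -/
def pr (p q : ℕ) : V p q →ₗ[ℝ] Z q where
  toFun v := fun μ => v (Sum.inr μ)
  map_add' _ _ := rfl
  map_smul' _ _ := rfl

/-- The plane `z₀` as a subspace of `V(ℝ)`. -/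
def z₀ (p q : ℕ) : Submodule ℝ (V p q) := LinearMap.range (incl p q)

/-- The Euclidean inner product `⟨w, w'⟩ = -Q(w, w')` on `z₀`. -/
def fiberInner (p : ℕ) {q : ℕ} (w w' : Z q) : ℝ := -form (incl p q w) (incl p q w')

/-- The orthogonal group `G(ℝ)` of `Q`. -/
def orthogonalGroup (p q : ℕ) : Subgroup (GL (Fin p ⊕ Fin q) ℝ) where
  carrier := {g | ∀ v w : V p q, form (g.1.mulVec v) (g.1.mulVec w) = form v w}
  mul_mem' {a b} ha hb v w := by
    have h := ha (b.1.mulVec v) (b.1.mulVec w)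
    rw [hb] at h
    simpa [Matrix.mulVec_mulVec] using h
  one_mem' v w := by simp
  inv_mem' {a} ha v w := by
    have h := ha ((a⁻¹).1.mulVec v) ((a⁻¹).1.mulVec w)
    have e : a.1 * (a⁻¹).1 = 1 := a.mul_inv
    rw [Matrix.mulVec_mulVec, Matrix.mulVec_mulVec, e, Matrix.one_mulVec, Matrix.one_mulVec] at h
    exact h.symm

/-- `G(ℝ)⁺`, the connected component of the identity. -/
def Gplus (p q : ℕ) : Subgroup (orthogonalGroup p q) :=
  Subgroup.connectedComponentOfOne (orthogonalGroup p q)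

/-- The matrix of an element of `G(ℝ)⁺`. -/
def mat {p q : ℕ} (g : Gplus p q) : Matrix (Fin p ⊕ Fin q) (Fin p ⊕ Fin q) ℝ := g.1.1.1

/-- The action of `G(ℝ)⁺` on `V(ℝ)`. -/
def act {p q : ℕ} (g : Gplus p q) : V p q →ₗ[ℝ] V p q := (mat g).mulVecLin

lemma mat_mul {p q : ℕ} (g h : Gplus p q) : mat (g * h) = mat g * mat h := rfl

lemma mat_one {p q : ℕ} : mat (1 : Gplus p q) = 1 := rfl

lemma act_mul {p q : ℕ} (g h : Gplus p q) (v : V p q) : act (g * h) v = act g (act h v) := by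
  simp [act, mat_mul, Matrix.mulVec_mulVec]

lemma act_one {p q : ℕ} (v : V p q) : act (1 : Gplus p q) v = v := by
  simp [act, mat_one]

lemma act_inv_act {p q : ℕ} (g : Gplus p q) (v : V p q) : act g⁻¹ (act g v) = v := by
  rw [← act_mul, inv_mul_cancel, act_one]

lemma act_act_inv {p q : ℕ} (g : Gplus p q) (v : V p q) : act g (act g⁻¹ v) = v := by
  rw [← act_mul, mul_inv_cancel, act_one]

lemma form_act {p q : ℕ} (g : Gplus p q) (v w : V p q) :
    form (act g v) (act g w) = form v w := g.1.2 v w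

/-- `K`, the stabilizer of `z₀` in `G(ℝ)⁺`. (By connectedness it preserves the orientation of
`z₀` too.) -/
def K (p q : ℕ) : Subgroup (Gplus p q) where
  carrier := {k | (z₀ p q).map (act k) = z₀ p q}
  mul_mem' {a b} ha hb := by
    have e : act (a * b) = act a ∘ₗ act b := LinearMap.ext fun v => act_mul a b v
    change (z₀ p q).map (act (a * b)) = z₀ p q
    rw [e, Submodule.map_comp, show (z₀ p q).map (act b) = z₀ p q from hb]
    exact ha
  one_mem' := by
    have e : act (1 : Gplus p q) = LinearMap.id := LinearMap.ext fun v => act_one v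
    change (z₀ p q).map (act (1 : Gplus p q)) = z₀ p q
    rw [e, Submodule.map_id]
  inv_mem' {a} ha := by
    have e : act a⁻¹ ∘ₗ act a = LinearMap.id := LinearMap.ext fun v => act_inv_act a v
    change (z₀ p q).map (act a⁻¹) = z₀ p q
    conv_lhs => rw [← show (z₀ p q).map (act a) = z₀ p q from ha]
    rw [← Submodule.map_comp, e, Submodule.map_id]

lemma form_add_left {p q : ℕ} (u v w : V p q) : form (u + v) w = form u w + form v w := by
  simp only [form, Pi.add_apply, add_mul, Finset.sum_add_distrib]; ring

lemma form_smul_left {p q : ℕ} (c : ℝ) (v w : V p q) : form (c • v) w = c * form v w := by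
  simp only [form, Pi.smul_apply, smul_eq_mul, mul_sub, Finset.mul_sum, mul_assoc]

lemma form_comm {p q : ℕ} (v w : V p q) : form v w = form w v := by
  simp only [form, mul_comm]

lemma form_add_right {p q : ℕ} (u v w : V p q) : form u (v + w) = form u v + form u w := by
  rw [form_comm, form_add_left, form_comm v, form_comm w]

lemma form_smul_right {p q : ℕ} (c : ℝ) (v w : V p q) : form v (c • w) = c * form v w := by
  rw [form_comm, form_smul_left, form_comm w]

/-- The Lie algebra `𝔤` of `G(ℝ)⁺`: the matrices that are skew for `Q`, that is, the block
matrices `(A x; ᵗx B)` with `A` and `B` skew-symmetric. -/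
def LieG (p q : ℕ) : Submodule ℝ (Matrix (Fin p ⊕ Fin q) (Fin p ⊕ Fin q) ℝ) where
  carrier := {A | ∀ v w : V p q, form (A.mulVec v) w = -form v (A.mulVec w)}
  add_mem' {A B} hA hB v w := by
    rw [Matrix.add_mulVec, Matrix.add_mulVec, form_add_left, form_add_right, hA, hB]; ring
  zero_mem' v w := by simp [form]
  smul_mem' c A hA v w := by
    rw [Matrix.smul_mulVec, Matrix.smul_mulVec, form_smul_left, form_smul_right, hA]; ring

/-- The Gram matrix of `Q`. -/
def gram (p q : ℕ) : Matrix (Fin p ⊕ Fin q) (Fin p ⊕ Fin q) ℝ :=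
  Matrix.diagonal (Sum.elim (fun _ => 1) (fun _ => -1))

lemma form_eq_dotProduct {p q : ℕ} (v w : V p q) : form v w = v ⬝ᵥ (gram p q).mulVec w := by
  simp [form, gram, dotProduct, Matrix.mulVec_diagonal, Fintype.sum_sum_type, sub_eq_add_neg]

lemma gram_mul_gram (p q : ℕ) : gram p q * gram p q = 1 := by
  rw [gram, Matrix.diagonal_mul_diagonal, ← Matrix.diagonal_one]
  congr 1
  ext (i | i) <;> simp

lemma mem_LieG_iff {p q : ℕ} (A : Matrix (Fin p ⊕ Fin q) (Fin p ⊕ Fin q) ℝ) :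
    A ∈ LieG p q ↔ A.transpose * gram p q = -(gram p q * A) := by
  have h1 : ∀ v w : V p q, form (A.mulVec v) w = v ⬝ᵥ (A.transpose * gram p q).mulVec w := by
    intro v w
    rw [form_eq_dotProduct, ← Matrix.mulVec_mulVec, Matrix.dotProduct_mulVec v,
      Matrix.vecMul_transpose]
  have h2 : ∀ v w : V p q, -form v (A.mulVec w) = v ⬝ᵥ (-(gram p q * A)).mulVec w := by
    intro v w
    rw [form_eq_dotProduct, Matrix.mulVec_mulVec, Matrix.neg_mulVec, dotProduct_neg]
  change (∀ v w : V p q, form (A.mulVec v) w = -form v (A.mulVec w)) ↔ _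
  constructor
  · intro h
    ext i j
    have := h (Pi.single i 1) (Pi.single j 1)
    rw [h1, h2] at this
    simpa using this
  · intro h v w
    rw [h1, h2, h]

/-- The Lie bracket of `𝔤`, the commutator of matrices. -/
def bracket {p q : ℕ} (A B : LieG p q) : LieG p q :=
  ⟨A.1 * B.1 - B.1 * A.1, fun v w => by
    have hA := A.2
    have hB := B.2
    change ∀ v w : V p q, form (A.1.mulVec v) w = -form v (A.1.mulVec w) at hA
    change ∀ v w : V p q, form (B.1.mulVec v) w = -form v (B.1.mulVec w) at hB
    rw [sub_eq_add_neg, ← neg_one_smul ℝ (B.1 * A.1), Matrix.add_mulVec, Matrix.add_mulVec,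
      Matrix.smul_mulVec, Matrix.smul_mulVec, form_add_left, form_add_right, form_smul_left,
      form_smul_right, ← Matrix.mulVec_mulVec, ← Matrix.mulVec_mulVec, ← Matrix.mulVec_mulVec,
      ← Matrix.mulVec_mulVec, hA, hB, hB, hA]
    ring⟩

/-- The projection of `𝔤 = 𝔨 ⊕ 𝔭` onto `𝔨`: it keeps the diagonal blocks. -/
def projK (p q : ℕ) : LieG p q →ₗ[ℝ] LieG p q where
  toFun A := ⟨Matrix.fromBlocks A.1.toBlocks₁₁ 0 0 A.1.toBlocks₂₂, by
    have h := (mem_LieG_iff A.1).1 A.2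
    rw [mem_LieG_iff]
    ext (i | i) (j | j)
    · simpa [gram, Matrix.toBlocks₁₁] using congrFun (congrFun h (Sum.inl i)) (Sum.inl j)
    · simp [gram]
    · simp [gram]
    · simpa [gram, Matrix.toBlocks₂₂] using congrFun (congrFun h (Sum.inr i)) (Sum.inr j)⟩
  map_add' A B := by
    ext (i | i) (j | j) <;> simp [Matrix.toBlocks₁₁, Matrix.toBlocks₂₂]
  map_smul' c A := by
    ext (i | i) (j | j) <;> simp [Matrix.toBlocks₁₁, Matrix.toBlocks₂₂]

/-- The Lie algebra `𝔨` of `K`, as a subspace of `𝔤`. -/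
def LieK (p q : ℕ) : Submodule ℝ (LieG p q) := LinearMap.range (projK p q)

/-- The adjoint action `Ad(g) A = g A g⁻¹` on `𝔤`. -/
def Ad {p q : ℕ} (g : Gplus p q) : LieG p q →ₗ[ℝ] LieG p q where
  toFun A := ⟨mat g * A.1 * mat g⁻¹, fun v w => by
    have h1 := form_act g (A.1.mulVec ((mat g⁻¹).mulVec v)) (act g⁻¹ w)
    have h2 := form_act g (act g⁻¹ v) (A.1.mulVec ((mat g⁻¹).mulVec w))
    rw [act_act_inv] at h1 h2
    have h3 := A.2 (act g⁻¹ v) (act g⁻¹ w)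
    simp only [act, Matrix.mulVecLin_apply] at h1 h2 h3
    rw [← Matrix.mulVec_mulVec, ← Matrix.mulVec_mulVec, ← Matrix.mulVec_mulVec,
      ← Matrix.mulVec_mulVec, h1, h2, h3]⟩
  map_add' A B := by
    ext i j; simp [mul_add, add_mul]
  map_smul' c A := by
    ext i j; simp

/-- The representation of `𝔤`-matrices on `z₀`: `X ↦ X|_{z₀}`, which for `X ∈ 𝔨` is the derivative
of the representation of `K` on `z₀`. -/
def rhoLie (p q : ℕ) : LieG p q →ₗ[ℝ] Z q →ₗ[ℝ] Z q :=
  LinearMap.mk₂ ℝ (fun X w => pr p q (X.1.mulVec (incl p q w)))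
    (fun X Y w => by simp [Matrix.add_mulVec])
    (fun c X w => by simp [Matrix.smul_mulVec])
    (fun X w w' => by simp [Matrix.mulVec_add])
    (fun c X w => by simp [Matrix.mulVec_smul])

/-- The action of `g` on `z₀`; for `g ∈ K` this is the representation `ρ(g) = g|_{z₀}`. -/
def rho {p q : ℕ} (g : Gplus p q) : Z q →ₗ[ℝ] Z q := pr p q ∘ₗ act g ∘ₗ incl p q

lemma form_exp {p q : ℕ} (A : LieG p q) (v w : V p q) :
    form ((NormedSpace.exp A.1).mulVec v) ((NormedSpace.exp A.1).mulVec w) = form v w := by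
  have hA := (mem_LieG_iff A.1).1 A.2
  have hinv : (gram p q)⁻¹ = gram p q := Matrix.inv_eq_right_inv (gram_mul_gram p q)
  have hu : IsUnit (gram p q) := IsUnit.of_mul_eq_one _ (gram_mul_gram p q)
  have h1 : A.1.transpose = gram p q * (-A.1) * (gram p q)⁻¹ := by
    rw [hinv, mul_neg, ← hA, mul_assoc, gram_mul_gram, mul_one]
  have h2 : (NormedSpace.exp A.1).transpose
      = gram p q * NormedSpace.exp (-A.1) * gram p q := by
    rw [← Matrix.exp_transpose, h1, Matrix.exp_conj _ _ hu, hinv]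
  have h3 : NormedSpace.exp (-A.1) * NormedSpace.exp A.1 = 1 := by
    rw [← Matrix.exp_add_of_commute _ _ (Commute.neg_left (Commute.refl A.1)), neg_add_cancel,
      NormedSpace.exp_zero]
  have h4 : (NormedSpace.exp A.1).transpose * (gram p q * NormedSpace.exp A.1) = gram p q := by
    rw [h2, mul_assoc, ← mul_assoc (gram p q) (gram p q), gram_mul_gram, one_mul, mul_assoc, h3,
      mul_one]
  conv_rhs => rw [form_eq_dotProduct, ← h4, ← Matrix.mulVec_mulVec, ← Matrix.mulVec_mulVec,
    Matrix.dotProduct_mulVec v, Matrix.vecMul_transpose]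
  rw [form_eq_dotProduct]

/-- `exp A` as an element of the orthogonal group. -/
def expO {p q : ℕ} (A : LieG p q) : orthogonalGroup p q :=
  ⟨⟨NormedSpace.exp A.1, NormedSpace.exp (-A.1),
    by rw [← Matrix.exp_add_of_commute _ _ (Commute.neg_right (Commute.refl A.1)), add_neg_cancel,
      NormedSpace.exp_zero],
    by rw [← Matrix.exp_add_of_commute _ _ (Commute.neg_left (Commute.refl A.1)), neg_add_cancel,
      NormedSpace.exp_zero]⟩, form_exp A⟩

lemma expO_mem_Gplus {p q : ℕ} (A : LieG p q) : expO A ∈ Gplus p q := by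
  have hexp : Continuous (NormedSpace.exp :
      Matrix (Fin p ⊕ Fin q) (Fin p ⊕ Fin q) ℝ → Matrix (Fin p ⊕ Fin q) (Fin p ⊕ Fin q) ℝ) :=
    open scoped Matrix.Norms.Operator in NormedSpace.exp_continuous
  have hc : Continuous fun t : ℝ => expO (t • A) := by
    refine Continuous.subtype_mk (Units.continuous_iff.2 ⟨?_, ?_⟩) _
    · exact hexp.comp (continuous_id.smul continuous_const)
    · exact hexp.comp (continuous_id.smul continuous_const).neg
  have h0 : expO ((0 : ℝ) • A) = 1 := by
    apply Subtype.ext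
    apply Units.ext
    simp [expO]
  have h1 : expO ((1 : ℝ) • A) = expO A := by rw [one_smul]
  have hr := (isPreconnected_range hc).subset_connectedComponent (x := 1) ⟨0, h0⟩
  exact hr ⟨1, h1⟩

/-- The exponential map `𝔤 → G(ℝ)⁺`. -/
def expG {p q : ℕ} (A : LieG p q) : Gplus p q := ⟨expO A, expO_mem_Gplus A⟩

/-! ## The symmetric space, the bundle and the section `s_v` -/

/-- `𝔻⁺`, identified with `G(ℝ)⁺ / K` by `g K ↦ g z₀`. -/
abbrev DPlus (p q : ℕ) : Type := Gplus p q ⧸ K p q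

/-- The relation on `G(ℝ)⁺ × z₀` that identifies `(g, w)` with `(g k, k⁻¹ w)` for `k ∈ K`. -/
def bundleSetoid (p q : ℕ) : Setoid (Gplus p q × Z q) where
  r x y := ∃ k ∈ K p q, y.1 = x.1 * k ∧ act k (incl p q y.2) = incl p q x.2
  iseqv :=
    { refl := fun x => ⟨1, one_mem _, by simp, act_one _⟩
      symm := by
        rintro x y ⟨k, hk, h1, h2⟩
        exact ⟨k⁻¹, inv_mem hk, by simp [h1], by rw [← h2, act_inv_act]⟩
      trans := by
        rintro x y z ⟨k, hk, h1, h2⟩ ⟨l, hl, h3, h4⟩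
        exact ⟨k * l, mul_mem hk hl, by rw [h3, h1, mul_assoc], by rw [act_mul, h4, h2]⟩ }

/-- The total space of the bundle `E = G(ℝ)⁺ ×_K z₀` over `𝔻⁺`. -/
def E (p q : ℕ) : Type := Quotient (bundleSetoid p q)

/-- The class `[g, w]`. -/
def E.mk {p q : ℕ} (g : Gplus p q) (w : Z q) : E p q := Quotient.mk (bundleSetoid p q) (g, w)

lemma form_incl {p q : ℕ} (v : V p q) (w : Z q) :
    form v (incl p q w) = form (incl p q (pr p q v)) (incl p q w) := by
  simp [form, incl, pr]

/-- Elements of `K` commute with the orthogonal projection onto `z₀`. -/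
lemma act_incl_pr {p q : ℕ} (k : Gplus p q) (hk : k ∈ K p q) (u : V p q) :
    act k (incl p q (pr p q u)) = incl p q (pr p q (act k u)) := by
  have hmap : (z₀ p q).map (act k) = z₀ p q := hk
  have hmem : act k (incl p q (pr p q u)) ∈ z₀ p q := by
    rw [← hmap]; exact Submodule.mem_map_of_mem ⟨_, rfl⟩
  obtain ⟨w, hw⟩ := hmem
  have key : ∀ w' : Z q, form (incl p q w) (incl p q w')
      = form (incl p q (pr p q (act k u))) (incl p q w') := by
    intro w'
    have h' : incl p q w' ∈ (z₀ p q).map (act k) := by rw [hmap]; exact ⟨_, rfl⟩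
    obtain ⟨_, ⟨y, rfl⟩, hy⟩ := h'
    rw [hw, ← form_incl, ← hy, form_act, form_act, form_incl u]
  rw [← hw]
  congr 1
  ext μ
  have := key (Pi.single μ 1)
  simpa [form, incl, Pi.single_apply] using this

/-- The section `s_v : z ↦ [g_z, pr(g_z⁻¹ v)]` of `E`, where `z = g_z z₀`. -/
def sectionV {p q : ℕ} (v : V p q) : DPlus p q → E p q :=
  Quotient.lift (fun g : Gplus p q => E.mk g (pr p q (act g⁻¹ v))) (by
    intro g g' h
    have hk : g⁻¹ * g' ∈ K p q := QuotientGroup.leftRel_apply.1 h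
    refine Quotient.sound ⟨g⁻¹ * g', hk, by simp, ?_⟩
    change act (g⁻¹ * g') (incl p q (pr p q (act g'⁻¹ v))) = incl p q (pr p q (act g⁻¹ v))
    rw [act_incl_pr _ hk, act_mul, act_act_inv])

/-- The function `f_s : G(ℝ)⁺ → z₀` attached to a section `s` of `E`: `s(g z₀) = [g, f_s(g)]`. -/
def sectionMap {p q : ℕ} (s : DPlus p q → E p q) (g : Gplus p q) : Z q :=
  Function.invFun (fun w : Z q => E.mk g w) (s (QuotientGroup.mk g))

/-! ## Differential forms

Tangent vectors of `G(ℝ)⁺` at `g` are identified with `𝔤` by left translation: `A ∈ 𝔤` stands for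
the velocity of `t ↦ g exp(tA)`. Likewise `(A, u) ∈ 𝔤 × z₀` stands for the velocity of
`t ↦ (g exp(tA), w + tu)` at the point `(g, w)` of `G(ℝ)⁺ × z₀`. A differential form on one of
these manifolds is thus a function to the exterior algebra of `𝔤*`, resp. of `(𝔤 × z₀)*`.
Differential forms on the quotients `𝔻⁺ = G(ℝ)⁺ / K` and `E = (G(ℝ)⁺ × z₀) / K` are the basic forms:
those that are horizontal and `K`-invariant. -/

/-- The exterior algebra `⋀ T*` of the dual of `T`. -/
abbrev Forms (T : Type) [AddCommGroup T] [Module ℝ T] : Type :=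
  ExteriorAlgebra ℝ (Module.Dual ℝ T)

/-- The curve `t ↦ g exp(tA)`. -/
def curveG {p q : ℕ} (g : Gplus p q) (A : LieG p q) (t : ℝ) : Gplus p q := g * expG (t • A)

/-- The curve `t ↦ (g exp(tA), w + tu)`. -/
def curveE {p q : ℕ} (x : Gplus p q × Z q) (ξ : LieG p q × Z q) (t : ℝ) : Gplus p q × Z q :=
  (curveG x.1 ξ.1 t, x.2 + t • ξ.2)

open Classical in
/-- The differential at `x` of a `z₀`-valued function: the linear map that sends a tangent vector
`ξ` to the derivative of the function along the curve of direction `ξ` (and `0` if there is no such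
linear map). -/
def differential {P T : Type} [AddCommGroup T] [Module ℝ T] {q : ℕ} (curve : P → T → ℝ → P)
    (f : P → Z q) (x : P) : T →ₗ[ℝ] Z q :=
  if h : ∃ L : T →ₗ[ℝ] Z q, ∀ ξ : T, HasDerivAt (fun t : ℝ => f (curve x ξ t)) (L ξ) 0 then
    h.choose
  else 0

/-- The pullback of (the value at a point of) a form by a linear map of tangent spaces. -/
def pullbackLin {T T' : Type} [AddCommGroup T] [Module ℝ T] [AddCommGroup T'] [Module ℝ T']
    (L : T →ₗ[ℝ] T') : Forms T' →ₐ[ℝ] Forms T :=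
  ExteriorAlgebra.map L.dualMap

/-- The interior product `ι_ξ`. -/
def interior {T : Type} [AddCommGroup T] [Module ℝ T] (ξ : T) : Forms T →ₗ[ℝ] Forms T :=
  CliffordAlgebra.contractLeft (Module.Dual.eval ℝ T ξ)

/-- The pullback `s^* α` to `𝔻⁺` of a form `α` on `E` by a section `s` of `E`: on the level of
`G(ℝ)⁺` it is the pullback by `g ↦ (g, f_s(g))`, which covers `s`. -/
def pullbackSection {p q : ℕ} (s : DPlus p q → E p q)
    (α : Gplus p q × Z q → Forms (LieG p q × Z q)) (g : Gplus p q) : Forms (LieG p q) :=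
  pullbackLin (LinearMap.prod LinearMap.id (differential curveG (sectionMap s) g))
    (α (g, sectionMap s g))

/-- A function on a subset `P` of a normed space `W`, with values in a finite-dimensional space, is
smooth if each of its coordinates is the restriction of a smooth function. It is used for the closed
submanifold of the space of matrices `G(ℝ)⁺`, and for `G(ℝ)⁺ × z₀`. -/
def IsSmooth {P W A : Type} [NormedAddCommGroup W] [NormedSpace ℝ W] [AddCommGroup A] [Module ℝ A]
    (emb : P → W) (α : P → A) : Prop :=
  ∀ ℓ : Module.Dual ℝ A, ∃ F : W → ℝ, ContDiff ℝ ((⊤ : ℕ∞) : WithTop ℕ∞) F ∧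
    ∀ x, F (emb x) = ℓ (α x)

/-- The matrix entries, as a point of a normed space. -/
def entries {p q : ℕ} (g : Gplus p q) : Fin p ⊕ Fin q → Fin p ⊕ Fin q → ℝ := fun i j => mat g i j

/-- `α` is a smooth `n`-form on `Δ \ 𝔻⁺`, that is, a smooth basic `n`-form on `G(ℝ)⁺` invariant
under left translation by `Δ`. -/
structure IsFormOnD {p q : ℕ} (Δ : Subgroup (Gplus p q)) (n : ℕ)
    (α : Gplus p q → Forms (LieG p q)) : Prop where
  degree : ∀ g, α g ∈ ⋀[ℝ]^n (Module.Dual ℝ (LieG p q))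
  smooth : IsSmooth (entries (p := p) (q := q)) α
  /-- `X ∈ 𝔨` stands for the vertical vector `d/dt (g exp(tX))`. -/
  horizontal : ∀ g, ∀ X ∈ LieK p q, interior X (α g) = 0
  /-- `R_k^* α = α`; left translations turn the differential of `R_k` into `Ad(k⁻¹)`. -/
  invariant : ∀ g, ∀ k ∈ K p q, pullbackLin (Ad k⁻¹) (α (g * k)) = α g
  leftInvariant : ∀ δ ∈ Δ, ∀ g, α (δ * g) = α g

/-- `α` is a smooth `n`-form on `Δ \ E`, that is, a smooth basic `n`-form on `G(ℝ)⁺ × z₀` invariant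
under left translation by `Δ`. -/
structure IsFormOnE {p q : ℕ} (Δ : Subgroup (Gplus p q)) (n : ℕ)
    (α : Gplus p q × Z q → Forms (LieG p q × Z q)) : Prop where
  degree : ∀ x, α x ∈ ⋀[ℝ]^n (Module.Dual ℝ (LieG p q × Z q))
  smooth : IsSmooth (fun x : Gplus p q × Z q => (entries x.1, x.2)) α
  /-- `(X, -X w)` is the vertical vector `d/dt (g exp(tX), exp(-tX) w)`. -/
  horizontal : ∀ g w, ∀ X ∈ LieK p q, interior (X, -rhoLie p q X w) (α (g, w)) = 0
  /-- `R_k^* α = α` for `R_k (g, w) = (g k, k⁻¹ w)`. -/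
  invariant : ∀ g w, ∀ k ∈ K p q,
    pullbackLin (LinearMap.prodMap (Ad k⁻¹) (rho k⁻¹)) (α (g * k, rho k⁻¹ w)) = α (g, w)
  leftInvariant : ∀ δ ∈ Δ, ∀ g w, α (δ * g, w) = α (g, w)

/-! ## The Mathai–Quillen form -/

/-- The connection form `θ̃` on `G(ℝ)⁺ × z₀`, the pullback of the projection to `𝔨` of the
Maurer–Cartan form (which is the identity of `𝔤` in the left trivialization). -/
def connection (p q : ℕ) : LieG p q × Z q →ₗ[ℝ] LieG p q :=
  projK p q ∘ₗ LinearMap.fst ℝ (LieG p q) (Z q)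

/-- The covariant derivative `df + ρ(θ̃) f` at `x` of `f : G(ℝ)⁺ × z₀ → z₀`. -/
def covariantDerivative {p q : ℕ} (f : Gplus p q × Z q → Z q) (x : Gplus p q × Z q) :
    LieG p q × Z q →ₗ[ℝ] Z q :=
  differential curveE f x + (rhoLie p q).flip (f x) ∘ₗ connection p q

/-- The curvature `R̃(ξ, η) = [θ̃(ξ), θ̃(η)] - θ̃([ξ, η])` on invariant vector fields of
`G(ℝ)⁺ × z₀`, where `[(A, u), (B, u')] = ([A, B], 0)`. -/
def curvature {p q : ℕ} (ξ η : LieG p q × Z q) : LieG p q :=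
  bracket (connection p q ξ) (connection p q η) - connection p q (bracket ξ.1 η.1, 0)

/-- The element of `⋀² T*` given by an alternating bilinear form `β` on `T`. -/
def twoForm {T : Type} [AddCommGroup T] [Module ℝ T] [FiniteDimensional ℝ T] (β : T → T → ℝ) :
    Forms T :=
  (1 / 2 : ℝ) • ∑ a, ∑ b, β (Module.finBasis ℝ T a) (Module.finBasis ℝ T b) •
    (ExteriorAlgebra.ι ℝ ((Module.finBasis ℝ T).coord a) *
      ExteriorAlgebra.ι ℝ ((Module.finBasis ℝ T).coord b))

/-- The value at a point of `⊕ Ω̃^{i,j}`: the algebra `⋀ T* ⊗ ⋀ z₀` with the product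
`(ω ⊗ s) ∧ (η ⊗ t) = (-1)^{jk} (ω ∧ η) ⊗ (s ∧ t)` for `s` of degree `j` and `η` of degree `k`. -/
abbrev BiForms (T : Type) [AddCommGroup T] [Module ℝ T] (q : ℕ) : Type :=
  GradedTensorProduct ℝ (fun i : ℕ => ⋀[ℝ]^i (Module.Dual ℝ T)) (fun j : ℕ => ⋀[ℝ]^j (Z q))

/-- The element `ω ⊗ s`. -/
def biTmul {T : Type} [AddCommGroup T] [Module ℝ T] {q : ℕ} (ω : Forms T)
    (s : ExteriorAlgebra ℝ (Z q)) : BiForms T q :=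
  GradedTensorProduct.tmul ℝ ω s

/-- The basis vector `e_μ` of `z₀` in `⋀ z₀`. -/
def eVec {q : ℕ} (μ : Fin q) : ExteriorAlgebra ℝ (Z q) :=
  ExteriorAlgebra.ι ℝ (Pi.single μ 1 : Z q)

/-- A `z₀`-valued `1`-form as an element of bidegree `(1, 1)`. -/
def vectorForm {T : Type} [AddCommGroup T] [Module ℝ T] {q : ℕ} (L : T →ₗ[ℝ] Z q) : BiForms T q :=
  ∑ μ, biTmul (ExteriorAlgebra.ι ℝ (LinearMap.proj μ ∘ₗ L)) (eVec μ)

/-- The curvature `ρ(R̃)` as an element of bidegree `(2, 2)`, by the isomorphism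
`A ↦ ∑_{μ < ν} ⟨A e_μ, e_ν⟩ e_μ ∧ e_ν` of `𝔰𝔬(z₀)` with `⋀² z₀`. -/
def curvatureForm (p q : ℕ) : BiForms (LieG p q × Z q) q :=
  ∑ μ : Fin q, ∑ ν ∈ Finset.Ioi μ,
    biTmul (twoForm fun ξ η => fiberInner p (rhoLie p q (curvature ξ η) (Pi.single μ 1))
      (Pi.single ν 1)) (eVec μ * eVec ν)

open Classical in
/-- The exponential `∑ aᵏ / k!` in a finite-dimensional real algebra. Convergence is tested on the
linear functionals. -/
def algExp {A : Type} [Ring A] [Algebra ℝ A] (a : A) : A :=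
  if h : ∃ b : A, ∀ ℓ : Module.Dual ℝ A,
      HasSum (fun k : ℕ => (k.factorial : ℝ)⁻¹ * ℓ (a ^ k)) (ℓ b) then
    h.choose
  else 0

/-- The Berezin integral `s ↦ ⟨s, b₁ ∧ ⋯ ∧ b_q⟩` on `⋀ z₀`, for an oriented orthonormal basis `b` of
`z₀`. -/
def berezin (p : ℕ) {q : ℕ} (b : Fin q → Z q) : ExteriorAlgebra ℝ (Z q) →ₗ[ℝ] ℝ :=
  ExteriorAlgebra.liftAlternating (R := ℝ) (Pi.single q
    ((Matrix.detRowAlternating (R := ℝ) (n := Fin q)).compLinearMap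
      (LinearMap.pi fun j : Fin q =>
        ({ toFun := fun w => fiberInner p w (b j)
           map_add' := fun w w' => by
             simp only [fiberInner, map_add, form_add_left, neg_add]
           map_smul' := fun c w => by
             simp only [fiberInner, map_smul, form_smul_left, RingHom.id_apply, smul_eq_mul,
               mul_neg] } : Z q →ₗ[ℝ] ℝ))))

/-- The extended Berezin integral `ω ⊗ s ↦ (∫ᴮ s) ω`. -/
def berezinForm {T : Type} [AddCommGroup T] [Module ℝ T] (p : ℕ) {q : ℕ} (b : Fin q → Z q) :
    BiForms T q →ₗ[ℝ] Forms T :=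
  (TensorProduct.rid ℝ (Forms T)).toLinearMap ∘ₗ LinearMap.lTensor (Forms T) (berezin p b) ∘ₗ
    (GradedTensorProduct.of ℝ (fun i : ℕ => ⋀[ℝ]^i (Module.Dual ℝ T))
      (fun j : ℕ => ⋀[ℝ]^j (Z q))).symm.toLinearMap

/-- The function on `G(ℝ)⁺ × z₀` attached to the tautological section `𝐬[g, w] = [(g, w), w]`. -/
def tautological {p q : ℕ} (x : Gplus p q × Z q) : Z q := x.2

/-- The Mathai–Quillen form
`U_MQ = (-1)^{q(q+1)/2} (2π)^{-q/2} ∫ᴮ exp(-2π ‖𝐬‖² - 2√π ∇̃𝐬 + ρ(R̃))`, with `z₀` oriented by its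
orthonormal basis `b`. -/
def mathaiQuillen (p q : ℕ) (b : Fin q → Z q) (x : Gplus p q × Z q) : Forms (LieG p q × Z q) :=
  ((-1 : ℝ) ^ (q * (q + 1) / 2) * (2 * Real.pi) ^ (-(q : ℝ) / 2)) •
    berezinForm p b (algExp
      (-(2 * Real.pi * fiberInner p (tautological x) (tautological x)) •
          (1 : BiForms (LieG p q × Z q) q)
        - (2 * Real.sqrt Real.pi) • vectorForm (covariantDerivative tautological x)
        + curvatureForm p q))

/-! ## The Kudla–Millson form -/

/-- The Siegel majorant `Q⁺_{z₀}(v, v)`. -/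
def siegelMajorant {p q : ℕ} (v : V p q) : ℝ := ∑ i, v i ^ 2

lemma siegelMajorant_temperate (p q : ℕ) :
    Function.HasTemperateGrowth (fun v : V p q => -Real.pi * siegelMajorant v) := by
  unfold siegelMajorant
  have h : ∀ i, Function.HasTemperateGrowth (fun v : V p q => v i) := fun i =>
    (ContinuousLinearMap.proj (R := ℝ) (φ := fun _ : Fin p ⊕ Fin q => ℝ) i).hasTemperateGrowth
  exact (Function.HasTemperateGrowth.const _).mul
    (Function.HasTemperateGrowth.sum fun i _ => (h i).pow 2)

lemma norm_sq_le_siegelMajorant {p q : ℕ} (v : V p q) : ‖v‖ ^ 2 ≤ siegelMajorant v := by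
  have h0 : 0 ≤ siegelMajorant v := Finset.sum_nonneg fun i _ => sq_nonneg _
  rw [← Real.sqrt_le_sqrt_iff h0, Real.sqrt_sq (norm_nonneg _)]
  refine (pi_norm_le_iff_of_nonneg (Real.sqrt_nonneg _)).2 fun i => ?_
  rw [Real.norm_eq_abs]
  refine Real.abs_le_sqrt ?_
  exact Finset.single_le_sum (f := fun i => v i ^ 2) (fun i _ => sq_nonneg _) (Finset.mem_univ i)

lemma gaussian_decay (p q k n : ℕ) : ∃ C : ℝ, ∀ v : V p q, ‖v‖ ^ k *
    ‖iteratedFDeriv ℝ n (fun v : V p q => Real.exp (-Real.pi * siegelMajorant v)) v‖ ≤ C := by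
  have ht := siegelMajorant_temperate p q
  obtain ⟨m, C, hC, hb⟩ := ht.norm_iteratedFDeriv_le_uniform n
  set f : V p q → ℝ := fun v => -Real.pi * siegelMajorant v with hf
  have hD : ∀ v : V p q, ‖iteratedFDeriv ℝ n (fun v => Real.exp (f v)) v‖ ≤
      n.factorial * Real.exp (f v) * ((1 + C) * (1 + ‖v‖) ^ m) ^ n := by
    intro v
    refine norm_iteratedFDeriv_comp_le (g := Real.exp) (f := f) (N := (n : WithTop ℕ∞))
      Real.contDiff_exp (ht.1.of_le (by exact_mod_cast le_top)) le_rfl v ?_ ?_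
    · intro i _
      rw [norm_iteratedFDeriv_eq_norm_iteratedDeriv, iteratedDeriv_eq_iterate, Real.iter_deriv_exp,
        Real.norm_eq_abs, abs_of_pos (Real.exp_pos _)]
    · intro i hi hin
      have h1 : (1 : ℝ) ≤ (1 + ‖v‖) ^ m := one_le_pow₀ (by linarith [norm_nonneg v])
      have h2 : 1 ≤ (1 + C) * (1 + ‖v‖) ^ m := by nlinarith
      calc _ ≤ C * (1 + ‖v‖) ^ m := hb i hin v
        _ ≤ (1 + C) * (1 + ‖v‖) ^ m := by nlinarith
        _ ≤ _ := le_self_pow₀ h2 (by omega)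
  refine ⟨n.factorial * (1 + C) ^ n * ((k + m * n).factorial * Real.exp 2), fun v => ?_⟩
  have h3 : Real.exp (f v) ≤ Real.exp (-‖v‖ ^ 2) := by
    refine Real.exp_le_exp.2 ?_
    have := norm_sq_le_siegelMajorant v
    have := Real.pi_gt_three
    simp only [hf]
    nlinarith [sq_nonneg ‖v‖]
  have h4 : (1 + ‖v‖) ^ (k + m * n) ≤ (k + m * n).factorial * Real.exp (1 + ‖v‖) := by
    have := Real.pow_div_factorial_le_exp (1 + ‖v‖) (by positivity) (k + m * n)
    rwa [div_le_iff₀' (by positivity)] at this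
  have h5 : Real.exp (1 + ‖v‖) * Real.exp (-‖v‖ ^ 2) ≤ Real.exp 2 := by
    rw [← Real.exp_add]
    refine Real.exp_le_exp.2 ?_
    nlinarith [sq_nonneg (‖v‖ - 1 / 2)]
  calc ‖v‖ ^ k * ‖iteratedFDeriv ℝ n (fun v => Real.exp (f v)) v‖
      ≤ (1 + ‖v‖) ^ k * (n.factorial * Real.exp (-‖v‖ ^ 2) * ((1 + C) * (1 + ‖v‖) ^ m) ^ n) := by
        gcongr
        · linarith
        · exact (hD v).trans (by gcongr)
    _ = n.factorial * (1 + C) ^ n * ((1 + ‖v‖) ^ (k + m * n) * Real.exp (-‖v‖ ^ 2)) := by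
        rw [mul_pow, ← pow_mul, pow_add]; ring
    _ ≤ n.factorial * (1 + C) ^ n *
        (((k + m * n).factorial * Real.exp (1 + ‖v‖)) * Real.exp (-‖v‖ ^ 2)) := by gcongr
    _ ≤ _ := by
        rw [mul_assoc ((k + m * n).factorial : ℝ)]
        gcongr

/-- The Gaussian `exp(-π Q⁺_{z₀}(v, v))` as a Schwartz function. -/
def gaussian (p q : ℕ) : 𝓢(V p q, ℝ) where
  toFun v := Real.exp (-Real.pi * siegelMajorant v)
  smooth' := by unfold siegelMajorant; fun_prop
  decay' := gaussian_decay p q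

/-- The linear form `ω_{αμ}` on `𝔤`, from the basis dual to the `X_{ij} = T(e_i ∧ e_j)`, where
`X_{αμ} = E_{αμ} + E_{μα}`. -/
def omega {p q : ℕ} (α : Fin p) (μ : Fin q) : Module.Dual ℝ (LieG p q) where
  toFun A := A.1 (Sum.inl α) (Sum.inr μ)
  map_add' _ _ := rfl
  map_smul' _ _ := rfl

/-- The operator `x_α - (1/2π) ∂/∂x_α` on Schwartz functions. -/
def creation {p q : ℕ} (α : Fin p) : 𝓢(V p q, ℝ) →ₗ[ℝ] 𝓢(V p q, ℝ) :=
  (SchwartzMap.smulLeftCLM ℝ (fun v : V p q => v (Sum.inl α))).toLinearMap -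
    (1 / (2 * Real.pi)) •
      (LineDeriv.lineDerivOpCLM ℝ 𝓢(V p q, ℝ) (Pi.single (Sum.inl α) 1 : V p q)).toLinearMap

/-- The Howe operator `2^{-q} ∏_μ ∑_α A_{αμ} ⊗ (x_α - (1/2π) ∂/∂x_α)`, the factors composed in the
order of the indices `μ`, where `A_{αμ}` is left multiplication by `ω_{αμ}`. -/
def howe (p q : ℕ) : Module.End ℝ (Forms (LieG p q) ⊗[ℝ] 𝓢(V p q, ℝ)) :=
  (1 / 2 ^ q : ℝ) • (List.ofFn fun μ : Fin q => ∑ α : Fin p,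
    (TensorProduct.map (LinearMap.mulLeft ℝ (ExteriorAlgebra.ι ℝ (omega α μ))) (creation α) :
      Module.End ℝ (Forms (LieG p q) ⊗[ℝ] 𝓢(V p q, ℝ)))).prod

/-- The value at `v` of an element of `⋀ 𝔤* ⊗ 𝓢(V(ℝ))`. -/
def evalAt {p q : ℕ} (v : V p q) : Forms (LieG p q) ⊗[ℝ] 𝓢(V p q, ℝ) →ₗ[ℝ] Forms (LieG p q) :=
  (TensorProduct.rid ℝ (Forms (LieG p q))).toLinearMap ∘ₗ
    LinearMap.lTensor (Forms (LieG p q))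
      ({ toFun := fun f => f v
         map_add' := fun _ _ => rfl
         map_smul' := fun _ _ => rfl } : 𝓢(V p q, ℝ) →ₗ[ℝ] ℝ)

/-- The value `φ_KM(v)_e` at the base point. -/
def kudlaMillsonBase {p q : ℕ} (v : V p q) : Forms (LieG p q) :=
  evalAt v (howe p q (1 ⊗ₜ[ℝ] gaussian p q))

/-- The form `φ_KM(v)` on `𝔻⁺`: the extension of `φ_KM(v)_e` by the `G(ℝ)⁺`-invariance
`L_g^* φ_KM(v) = φ_KM(g⁻¹ v)`. -/
def kudlaMillson {p q : ℕ} (v : V p q) (g : Gplus p q) : Forms (LieG p q) :=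
  kudlaMillsonBase (act g⁻¹ v)

/-- The stabilizer `Γ_v` of `v` in `Γ`. -/
def stabilizerIn {p q : ℕ} (Γ : Subgroup (Gplus p q)) (v : V p q) : Subgroup (Gplus p q) where
  carrier := {γ | γ ∈ Γ ∧ act γ v = v}
  mul_mem' {a b} ha hb := ⟨mul_mem ha.1 hb.1, by rw [act_mul, hb.2, ha.2]⟩
  one_mem' := ⟨one_mem _, act_one v⟩
  inv_mem' {a} ha := ⟨inv_mem ha.1, by
    have h := act_inv_act a v
    rwa [ha.2] at h⟩

end

end KudlaMillson

/-! Both sides are values of one Hermite generating function. In `⋀ T* ⊗ ⋀ z₀` elements of bidegree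
(1,1) commute, so the exponent of `U_MQ`, apart from its scalar term, lies in a commutative algebra
and is nilpotent; exponentials are finite sums and multiplicative. Put `L_α = ∑_μ ω_{αμ} ⊗ e_μ`.

The curvature on `z₀` comes only from the bracket of `𝔭` with itself, and this gives `ρ(R̃) = -½ ∑_α
L_α²` (`curvatureForm_eq`). Let `u = g⁻¹v`. In the pullback of `∇̃𝐬` by `s_v`, the derivative of
`pr(g⁻¹v)` and the connection term cancel except on the positive part of `u`. The exponent becomes
`-2π‖pr u‖² + 2√π ∑_α u_α L_α - ½ ∑_α L_α²` (`biMap_mqExponent_section`).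

Let `D_α = x_α - (1/2π) ∂/∂x_α`. The Gaussian times the exponential of the nilpotent part is the
operator product of the factors `1 + √π ∑_α (ω_{αμ} ⊗ e_μ) D_α` applied to the Gaussian. This is
proved by adding one index `μ` at a time (`evalTensor_expansion`): the increment of the exponent
squares to zero because all its terms contain `e_μ`, so its exponential is one plus itself. The
Berezin integral keeps only the term containing every `e_μ`, which is the Howe operator applied to
the Gaussian, up to a constant (`expansion_sub_mem_lowerPart`, `gaussian_smul_berezinForm_nilExp`).

It remains to compare constants. Since `Q(v,v) = Q(u,u)`, the factors `e^{-πQ(v,v)}` and `e^{-2π‖pr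
u‖²}` combine to the Gaussian. Reordering the factors gives `(-1)^{q(q-1)/2}`, which with the sign
in `U_MQ` makes `(-1)^q`; the powers of `2` and `π` cancel (`const_identity`), and `ε² = 1`.

That the objects are forms follows from the same description. The Berezin integral of a polynomial
in bidegree (1,1) elements is a `q`-form in the 1-forms involved (`berezinForm_mem`), which gives
degree and horizontality. For `K`-invariance, `k` also acts on `⋀ z₀`, and the Berezin integral sees
this only through `det ρ(k)`, which is 1 by connectedness (`det_rho`). Smoothness holds because the
exponents are polynomial in the matrix entries and in `w`. -/

open scoped TensorProduct SchwartzMap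

namespace KudlaMillson

noncomputable section

/-! ## Exponentials of nilpotent elements -/

section NilpotentExp

variable {A B : Type} [Ring A] [Algebra ℝ A] [Ring B] [Algebra ℝ B]

/-- The exponential of a nilpotent element of a real algebra. -/
def nilExp (a : A) : A :=
  -- The rational structure is restricted from the real one, so that rational and real scalars agree
  -- by definition.
  letI : Module ℚ A := Module.compHom A (algebraMap ℚ ℝ)
  IsNilpotent.exp a

lemma nilExp_eq_sum {a : A} {k : ℕ} (h : a ^ k = 0) :
    nilExp a = ∑ i ∈ Finset.range k, (i.factorial : ℝ)⁻¹ • a ^ i := by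
  let _ : Module ℚ A := Module.compHom A (algebraMap ℚ ℝ)
  have e : ∀ (r : ℚ) (x : A), r • x = (r : ℝ) • x := fun _ _ => rfl
  rw [nilExp, IsNilpotent.exp_eq_sum h]
  simp [e]

lemma nilExp_add {a b : A} (h : Commute a b) (ha : IsNilpotent a) (hb : IsNilpotent b) :
    nilExp (a + b) = nilExp a * nilExp b := by
  let _ : Module ℚ A := Module.compHom A (algebraMap ℚ ℝ)
  exact IsNilpotent.exp_add_of_commute h ha hb

lemma map_nilExp (f : A →ₐ[ℝ] B) {a : A} (ha : IsNilpotent a) :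
    f (nilExp a) = nilExp (f a) := by
  let _ : Module ℚ A := Module.compHom A (algebraMap ℚ ℝ)
  let _ : Module ℚ B := Module.compHom B (algebraMap ℚ ℝ)
  exact IsNilpotent.map_exp ha f

lemma nilExp_mem {S : Subalgebra ℝ A} {a : A} (ha : IsNilpotent a) (h : a ∈ S) :
    nilExp a ∈ S := by
  obtain ⟨k, hk⟩ := ha
  rw [nilExp_eq_sum hk]
  exact sum_mem fun i _ => S.smul_mem (S.pow_mem h i) _

lemma nilExp_of_mul_self_eq_zero {a : A} (h : a * a = 0) : nilExp a = 1 + a := by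
  rw [nilExp_eq_sum (k := 2) (by rw [pow_two, h])]
  simp [Finset.sum_range_succ]

/-- The exponential series of `c + n`, with `c` a scalar and `n` nilpotent. -/
lemma hasSum_exp_smul_one_add (c : ℝ) {n : A} (hn : IsNilpotent n) (ℓ : Module.Dual ℝ A) :
    HasSum (fun k : ℕ => (k.factorial : ℝ)⁻¹ * ℓ ((c • (1 : A) + n) ^ k))
      (ℓ (Real.exp c • nilExp n)) := by
  obtain ⟨N, hN⟩ := hn
  have h1 : HasSum (fun k : ℕ => c ^ k / k.factorial) (Real.exp c) := by
    rw [Real.exp_eq_exp_ℝ]; exact NormedSpace.expSeries_div_hasSum_exp c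
  have hz : ∀ k ∉ Finset.range N, (k.factorial : ℝ)⁻¹ * ℓ (n ^ k) = 0 := by
    intro k hk
    rw [pow_eq_zero_of_le (by simpa using hk) hN, map_zero, mul_zero]
  have h2 : HasSum (fun k : ℕ => (k.factorial : ℝ)⁻¹ * ℓ (n ^ k)) (ℓ (nilExp n)) := by
    have := hasSum_sum_of_ne_finset_zero (L := .unconditional ℕ) hz
    rw [nilExp_eq_sum hN]
    simpa using this
  have s1 : Summable fun k : ℕ => ‖c ^ k / k.factorial‖ := h1.summable.norm
  have s2 : Summable fun k : ℕ => ‖(k.factorial : ℝ)⁻¹ * ℓ (n ^ k)‖ := h2.summable.norm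
  -- Cauchy product of the series of `exp c` and the finite series of `n`; the binomial theorem
  -- identifies its terms with those of `c + n`.
  have h3 := tsum_mul_tsum_eq_tsum_sum_antidiagonal_of_summable_norm s1 s2
  have h4 := (summable_norm_sum_mul_antidiagonal_of_summable_norm s1 s2).of_norm.hasSum
  rw [← h3, h1.tsum_eq, h2.tsum_eq] at h4
  rw [map_smul, smul_eq_mul]
  have h5 : ∀ k : ℕ, (k.factorial : ℝ)⁻¹ * ℓ ((c • (1 : A) + n) ^ k) =
      ∑ m ∈ Finset.HasAntidiagonal.antidiagonal k,
        c ^ m.1 / m.1.factorial * ((m.2.factorial : ℝ)⁻¹ * ℓ (n ^ m.2)) := by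
    intro k
    rw [((Commute.one_left n).smul_left c).add_pow', map_sum, Finset.mul_sum]
    refine Finset.sum_congr rfl fun m hm => ?_
    rw [smul_pow, one_pow, smul_mul_assoc, one_mul, map_nsmul, map_smul, nsmul_eq_mul, smul_eq_mul,
      ← Finset.HasAntidiagonal.mem_antidiagonal.1 hm, Nat.cast_add_choose]
    have := Nat.cast_ne_zero (R := ℝ).2 (Nat.factorial_ne_zero (m.1 + m.2))
    field_simp
  simp_rw [h5]
  exact h4

/-- Linear functionals separate points, so the element chosen in `algExp` is the only possible one.
-/
lemma algExp_smul_one_add (c : ℝ) {n : A} (hn : IsNilpotent n) :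
    algExp (c • (1 : A) + n) = Real.exp c • nilExp n := by
  have h : ∃ b : A, ∀ ℓ : Module.Dual ℝ A,
      HasSum (fun k : ℕ => (k.factorial : ℝ)⁻¹ * ℓ ((c • (1 : A) + n) ^ k)) (ℓ b) :=
    ⟨_, hasSum_exp_smul_one_add c hn⟩
  rw [algExp, dif_pos h, ← sub_eq_zero, ← Module.forall_dual_apply_eq_zero_iff ℝ]
  intro ℓ
  rw [map_sub, (h.choose_spec ℓ).unique (hasSum_exp_smul_one_add c hn ℓ), sub_self]

lemma hasDerivAt_mul_nilExp_smul (x : A) {z : A} (hz : IsNilpotent z) (ℓ : Module.Dual ℝ A) :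
    HasDerivAt (fun t : ℝ => ℓ (x * nilExp (t • z))) (ℓ (x * z)) 0 := by
  obtain ⟨N, hN⟩ := hz
  have h : ∀ t : ℝ, ℓ (x * nilExp (t • z)) =
      ∑ i ∈ Finset.range (N + 2), t ^ i * ((i.factorial : ℝ)⁻¹ * ℓ (x * z ^ i)) := by
    intro t
    -- The longer range guarantees that the index 1, the only one with a nonzero derivative at 0,
    -- occurs for every `N`.
    rw [nilExp_eq_sum (k := N + 2) (by rw [smul_pow, pow_add z, hN, zero_mul, smul_zero]),
      Finset.mul_sum, map_sum]
    refine Finset.sum_congr rfl fun i _ => ?_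
    rw [smul_pow, smul_smul, mul_smul_comm, map_smul, smul_eq_mul]
    ring
  simp_rw [h]
  have := HasDerivAt.fun_sum (u := Finset.range (N + 2)) (x := (0 : ℝ)) fun i _ =>
    (hasDerivAt_pow i (0 : ℝ)).mul_const ((i.factorial : ℝ)⁻¹ * ℓ (x * z ^ i))
  refine this.congr_deriv ?_
  rw [Finset.sum_eq_single_of_mem 1 (by simp)]
  · simp
  · intro i _ hi
    rcases i with _ | _ | i
    · simp
    · exact absurd rfl hi
    · simp

/-- In a power longer than the number of commuting square-zero terms, some term is repeated. -/
lemma sum_pow_card_succ_eq_zero {R ι : Type*} [Ring R] (s : Finset ι) (y : ι → R)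
    (hc : ∀ i j, Commute (y i) (y j)) (hy : ∀ i, y i * y i = 0) :
    (∑ i ∈ s, y i) ^ (s.card + 1) = 0 := by
  classical
  induction s using Finset.induction_on with
  | empty => simp
  | insert i s hi ih =>
    rw [Finset.sum_insert hi, Finset.card_insert_of_notMem hi]
    refine (Commute.sum_right _ _ _ fun j _ => hc i j).add_pow_eq_zero_of_add_le_succ_of_pow_eq_zero
      (m := 2) (n := s.card + 1) (by rw [pow_two, hy]) ih (by omega)

end NilpotentExp

/-! ## Smooth functions with values in an algebra -/

section Smooth

variable {W A B : Type} [NormedAddCommGroup W] [NormedSpace ℝ W] [AddCommGroup A] [Module ℝ A]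
  [AddCommGroup B] [Module ℝ B]

/-- The finite sums `∑ cᵢ aᵢ` with smooth coefficients `cᵢ`. -/
def smoothMaps (W A : Type) [NormedAddCommGroup W] [NormedSpace ℝ W] [AddCommGroup A]
    [Module ℝ A] : Submodule ℝ (W → A) :=
  Submodule.span ℝ {f | ∃ (c : W → ℝ) (a : A), ContDiff ℝ ((⊤ : ℕ∞) : WithTop ℕ∞) c ∧
    f = fun x => c x • a}

lemma smul_mem_smoothMaps {c : W → ℝ} (hc : ContDiff ℝ ((⊤ : ℕ∞) : WithTop ℕ∞) c) (a : A) :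
    (fun x => c x • a) ∈ smoothMaps W A :=
  Submodule.subset_span ⟨c, a, hc, rfl⟩

lemma const_mem_smoothMaps (a : A) : (fun _ => a) ∈ smoothMaps W A := by
  simpa using smul_mem_smoothMaps (W := W) (c := fun _ => 1) contDiff_const a

lemma contDiff_of_mem_smoothMaps {f : W → A} (hf : f ∈ smoothMaps W A) (ℓ : Module.Dual ℝ A) :
    ContDiff ℝ ((⊤ : ℕ∞) : WithTop ℕ∞) fun x => ℓ (f x) := by
  induction hf using Submodule.span_induction with
  | mem f hf =>
    obtain ⟨c, a, hc, rfl⟩ := hf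
    simp only [map_smul, smul_eq_mul]
    exact hc.mul contDiff_const
  | zero => simpa using contDiff_const
  | add f g _ _ hf hg => simpa using hf.add hg
  | smul r f _ hf => simpa using contDiff_const.mul hf

lemma map_mem_smoothMaps (L : A →ₗ[ℝ] B) {f : W → A} (hf : f ∈ smoothMaps W A) :
    (fun x => L (f x)) ∈ smoothMaps W B := by
  induction hf using Submodule.span_induction with
  | mem f hf =>
    obtain ⟨c, a, hc, rfl⟩ := hf
    simpa using smul_mem_smoothMaps hc (L a)
  | zero => simp only [Pi.zero_apply, map_zero]; exact zero_mem _
  | add f g _ _ hf hg => simp only [Pi.add_apply, map_add]; exact add_mem hf hg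
  | smul r f _ hf => simp only [Pi.smul_apply, map_smul]; exact Submodule.smul_mem _ r hf

lemma fun_smul_mem_smoothMaps {c : W → ℝ} (hc : ContDiff ℝ ((⊤ : ℕ∞) : WithTop ℕ∞) c) {f : W → A}
    (hf : f ∈ smoothMaps W A) : (fun x => c x • f x) ∈ smoothMaps W A := by
  induction hf using Submodule.span_induction with
  | mem f hf =>
    obtain ⟨c', a, hc', rfl⟩ := hf
    simpa [smul_smul] using smul_mem_smoothMaps (hc.mul hc') a
  | zero => simp only [Pi.zero_apply, smul_zero]; exact zero_mem _
  | add f g _ _ hf hg => simp only [Pi.add_apply, smul_add]; exact add_mem hf hg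
  | smul r f _ hf =>
    simp only [Pi.smul_apply, smul_comm (_ : ℝ) r]
    exact Submodule.smul_mem _ r hf

variable {R : Type} [Ring R] [Algebra ℝ R]

lemma mul_mem_smoothMaps {f g : W → R} (hf : f ∈ smoothMaps W R) (hg : g ∈ smoothMaps W R) :
    (fun x => f x * g x) ∈ smoothMaps W R := by
  induction hf using Submodule.span_induction with
  | mem f hf =>
    obtain ⟨c, a, hc, rfl⟩ := hf
    simpa using fun_smul_mem_smoothMaps hc (map_mem_smoothMaps (LinearMap.mulLeft ℝ a) hg)
  | zero => simp only [Pi.zero_apply, zero_mul]; exact zero_mem _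
  | add f g _ _ hf hg => simp only [Pi.add_apply, add_mul]; exact add_mem hf hg
  | smul r f _ hf => simp only [Pi.smul_apply, smul_mul_assoc]; exact Submodule.smul_mem _ r hf

lemma pow_mem_smoothMaps {f : W → R} (hf : f ∈ smoothMaps W R) (n : ℕ) :
    (fun x => f x ^ n) ∈ smoothMaps W R := by
  induction n with
  | zero => simpa using const_mem_smoothMaps (W := W) (1 : R)
  | succ n ih => simpa only [pow_succ] using mul_mem_smoothMaps ih hf

/-- A nilpotency order independent of the point makes the exponential one fixed polynomial in `f`.
-/
lemma nilExp_mem_smoothMaps {f : W → R} (hf : f ∈ smoothMaps W R) {N : ℕ}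
    (hN : ∀ x, f x ^ N = 0) : (fun x => nilExp (f x)) ∈ smoothMaps W R := by
  simp only [nilExp_eq_sum (hN _)]
  have : (fun x => ∑ i ∈ Finset.range N, (i.factorial : ℝ)⁻¹ • f x ^ i) =
      ∑ i ∈ Finset.range N, (i.factorial : ℝ)⁻¹ • fun x => f x ^ i := by
    ext x; simp
  rw [this]
  exact sum_mem fun i _ => Submodule.smul_mem _ _ (pow_mem_smoothMaps hf i)

lemma isSmooth_of_mem_smoothMaps {P : Type} {emb : P → W} {α : P → A} {f : W → A}
    (hf : f ∈ smoothMaps W A) (h : ∀ x, f (emb x) = α x) : IsSmooth emb α := fun ℓ =>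
  ⟨_, contDiff_of_mem_smoothMaps hf ℓ, fun x => by rw [h]⟩

end Smooth

/-! ## The bigraded algebra -/

section BiForms

variable {T T' : Type} [AddCommGroup T] [Module ℝ T] [AddCommGroup T'] [Module ℝ T'] {q : ℕ}

lemma biTmul_add_left (ω η : Forms T) (s : ExteriorAlgebra ℝ (Z q)) :
    biTmul (ω + η) s = biTmul ω s + biTmul η s := TensorProduct.add_tmul ω η s

lemma biTmul_add_right (ω : Forms T) (s t : ExteriorAlgebra ℝ (Z q)) :
    biTmul ω (s + t) = biTmul ω s + biTmul ω t := TensorProduct.tmul_add ω s t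

lemma biTmul_smul_left (c : ℝ) (ω : Forms T) (s : ExteriorAlgebra ℝ (Z q)) :
    biTmul (c • ω) s = c • biTmul ω s := TensorProduct.smul_tmul' c ω s

lemma biTmul_smul_right (c : ℝ) (ω : Forms T) (s : ExteriorAlgebra ℝ (Z q)) :
    biTmul ω (c • s) = c • biTmul ω s := TensorProduct.tmul_smul c ω s

/-- `biTmul` as a bilinear map. -/
def biTmulHom (T : Type) [AddCommGroup T] [Module ℝ T] (q : ℕ) :
    Forms T →ₗ[ℝ] ExteriorAlgebra ℝ (Z q) →ₗ[ℝ] BiForms T q :=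
  LinearMap.mk₂ ℝ biTmul biTmul_add_left biTmul_smul_left biTmul_add_right biTmul_smul_right

lemma biTmulHom_apply (ω : Forms T) (s : ExteriorAlgebra ℝ (Z q)) :
    biTmulHom T q ω s = biTmul ω s := rfl

lemma biTmul_one_one : biTmul (1 : Forms T) (1 : ExteriorAlgebra ℝ (Z q)) = 1 := rfl

lemma neg_one_units_pow_smul {M : Type} [AddCommGroup M] [Module ℝ M] (n : ℕ) (x : M) :
    (-1 : ℤˣ) ^ n • x = (-1 : ℝ) ^ n • x := by
  rcases Nat.even_or_odd n with e | e
  · rw [e.neg_one_pow, e.neg_one_pow, one_smul, one_smul]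
  · rw [e.neg_one_pow, e.neg_one_pow, neg_one_smul, Units.neg_smul, one_smul]

lemma biTmul_mul_biTmul {j k : ℕ} (ω : Forms T) {s : ExteriorAlgebra ℝ (Z q)}
    (hs : s ∈ ⋀[ℝ]^j (Z q)) {η : Forms T} (hη : η ∈ ⋀[ℝ]^k (Module.Dual ℝ T))
    (t : ExteriorAlgebra ℝ (Z q)) :
    biTmul ω s * biTmul η t = (-1 : ℝ) ^ (j * k) • biTmul (ω * η) (s * t) := by
  have h := GradedTensorProduct.tmul_coe_mul_coe_tmul (R := ℝ)
    (fun i : ℕ => ⋀[ℝ]^i (Module.Dual ℝ T)) (fun j : ℕ => ⋀[ℝ]^j (Z q)) ω ⟨s, hs⟩ ⟨η, hη⟩ t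
  refine h.trans ?_
  exact neg_one_units_pow_smul _ _

@[elab_as_elim]
lemma BiForms.induction {C : BiForms T q → Prop} (zero : C 0) (tmul : ∀ ω s, C (biTmul ω s))
    (add : ∀ x y, C x → C y → C (x + y)) (x : BiForms T q) : C x :=
  TensorProduct.induction_on (motive := C) x zero tmul add

/-! ### Commuting elements of bidegree (1,1) -/

/-- The generator `a ⊗ z` of bidegree `(1, 1)`. -/
def gen (a : Module.Dual ℝ T) (z : Z q) : BiForms T q :=
  biTmul (ExteriorAlgebra.ι ℝ a) (ExteriorAlgebra.ι ℝ z)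

/-- `gen` as a bilinear map. -/
def genHom (T : Type) [AddCommGroup T] [Module ℝ T] (q : ℕ) :
    Module.Dual ℝ T →ₗ[ℝ] Z q →ₗ[ℝ] BiForms T q :=
  (biTmulHom T q).compl₁₂ (ExteriorAlgebra.ι ℝ) (ExteriorAlgebra.ι ℝ)

lemma genHom_apply (a : Module.Dual ℝ T) (z : Z q) : genHom T q a z = gen a z := rfl

lemma ι_mem_exteriorPower_one {M : Type} [AddCommGroup M] [Module ℝ M] (m : M) :
    ExteriorAlgebra.ι ℝ m ∈ ⋀[ℝ]^1 M := by
  rw [ExteriorAlgebra.exteriorPower, pow_one]; exact ⟨m, rfl⟩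

lemma gen_mul_biTmul (a : Module.Dual ℝ T) (z : Z q) {k : ℕ} {η : Forms T}
    (hη : η ∈ ⋀[ℝ]^k (Module.Dual ℝ T)) (t : ExteriorAlgebra ℝ (Z q)) :
    gen a z * biTmul η t =
      (-1 : ℝ) ^ k • biTmul (ExteriorAlgebra.ι ℝ a * η) (ExteriorAlgebra.ι ℝ z * t) := by
  rw [gen, biTmul_mul_biTmul _ (ι_mem_exteriorPower_one z) hη, one_mul]

lemma gen_mul_gen (a a' : Module.Dual ℝ T) (z z' : Z q) :
    gen a z * gen a' z' = -biTmul (ExteriorAlgebra.ι ℝ a * ExteriorAlgebra.ι ℝ a')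
      (ExteriorAlgebra.ι ℝ z * ExteriorAlgebra.ι ℝ z') := by
  rw [gen.eq_def a', gen_mul_biTmul _ _ (ι_mem_exteriorPower_one a'), pow_one, neg_one_smul]

lemma ι_mul_ι_swap {M : Type} [AddCommGroup M] [Module ℝ M] (m m' : M) :
    ExteriorAlgebra.ι ℝ m * ExteriorAlgebra.ι ℝ m' =
      -(ExteriorAlgebra.ι ℝ m' * ExteriorAlgebra.ι ℝ m) :=
  eq_neg_of_add_eq_zero_left (ExteriorAlgebra.ι_add_mul_swap m m')

lemma biTmul_neg_neg (ω : Forms T) (s : ExteriorAlgebra ℝ (Z q)) :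
    biTmul (-ω) (-s) = biTmul ω s := by
  rw [← neg_one_smul ℝ ω, ← neg_one_smul ℝ s, biTmul_smul_left, biTmul_smul_right, smul_smul]
  norm_num

/-- Exchanging the two 1-forms and exchanging the two vectors each give a sign, and the signs
cancel. -/
lemma gen_commute (a a' : Module.Dual ℝ T) (z z' : Z q) : Commute (gen a z) (gen a' z') := by
  rw [Commute, SemiconjBy, gen_mul_gen, gen_mul_gen, ι_mul_ι_swap a, ι_mul_ι_swap z,
    biTmul_neg_neg]

lemma gen_mul_gen_self_right (a a' : Module.Dual ℝ T) (z : Z q) : gen a z * gen a' z = 0 := by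
  rw [gen_mul_gen, ExteriorAlgebra.ι_sq_zero, ← biTmulHom_apply, map_zero, neg_zero]

/-- The subalgebra generated by the `a ⊗ z` with `a ∈ M`. -/
def genAlg (q : ℕ) (M : Submodule ℝ (Module.Dual ℝ T)) : Subalgebra ℝ (BiForms T q) :=
  Algebra.adjoin ℝ {x | ∃ a ∈ M, ∃ z : Z q, x = gen a z}

lemma gen_mem_genAlg {M : Submodule ℝ (Module.Dual ℝ T)} {a : Module.Dual ℝ T} (ha : a ∈ M)
    (z : Z q) : gen a z ∈ genAlg q M := Algebra.subset_adjoin ⟨a, ha, z, rfl⟩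

lemma commute_of_mem_genAlg {M : Submodule ℝ (Module.Dual ℝ T)} {x y : BiForms T q}
    (hx : x ∈ genAlg q M) (hy : y ∈ genAlg q M) : Commute x y := by
  refine Algebra.commute_of_mem_adjoin_of_forall_mem_commute hy ?_
  rintro _ ⟨a, -, z, rfl⟩
  refine (Algebra.commute_of_mem_adjoin_of_forall_mem_commute hx ?_).symm
  rintro _ ⟨a', -, z', rfl⟩
  exact gen_commute _ _ _ _

lemma vectorForm_eq_sum_gen (L : T →ₗ[ℝ] Z q) :
    vectorForm L = ∑ μ, gen (LinearMap.proj μ ∘ₗ L) (Pi.single μ 1 : Z q) := rfl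

lemma vectorForm_mem_genAlg {M : Submodule ℝ (Module.Dual ℝ T)} {L : T →ₗ[ℝ] Z q}
    (h : ∀ μ, LinearMap.proj μ ∘ₗ L ∈ M) : vectorForm L ∈ genAlg q M :=
  sum_mem fun μ _ => gen_mem_genAlg (h μ) _

lemma vectorForm_commute (L L' : T →ₗ[ℝ] Z q) : Commute (vectorForm L) (vectorForm L') :=
  commute_of_mem_genAlg (M := ⊤) (vectorForm_mem_genAlg fun _ => trivial)
    (vectorForm_mem_genAlg fun _ => trivial)

lemma vectorForm_pow_eq_zero (L : T →ₗ[ℝ] Z q) : vectorForm L ^ (q + 1) = 0 := by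
  have h := sum_pow_card_succ_eq_zero (Finset.univ : Finset (Fin q))
    (fun μ => gen (LinearMap.proj μ ∘ₗ L) (Pi.single μ 1 : Z q))
    (fun _ _ => gen_commute _ _ _ _) (fun _ => gen_mul_gen_self_right _ _ _)
  rwa [Finset.card_univ, Fintype.card_fin] at h

lemma vectorForm_isNilpotent (L : T →ₗ[ℝ] Z q) : IsNilpotent (vectorForm L) :=
  ⟨_, vectorForm_pow_eq_zero L⟩

/-- `vectorForm` as a linear map. -/
def vectorFormHom (T : Type) [AddCommGroup T] [Module ℝ T] (q : ℕ) :
    (T →ₗ[ℝ] Z q) →ₗ[ℝ] BiForms T q where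
  toFun := vectorForm
  map_add' L L' := by
    simp only [vectorForm_eq_sum_gen, LinearMap.comp_add, ← genHom_apply, map_add,
      LinearMap.add_apply, Finset.sum_add_distrib]
  map_smul' c L := by
    simp only [vectorForm_eq_sum_gen, LinearMap.comp_smul, ← genHom_apply, map_smul,
      LinearMap.smul_apply, Finset.smul_sum, RingHom.id_apply]

lemma vectorFormHom_apply (L : T →ₗ[ℝ] Z q) : vectorFormHom T q L = vectorForm L := rfl

/-! ### Functoriality -/

lemma map_mem_exteriorPower {M N : Type} [AddCommGroup M] [Module ℝ M] [AddCommGroup N]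
    [Module ℝ N] (f : M →ₗ[ℝ] N) {k : ℕ} {x : ExteriorAlgebra ℝ M} (hx : x ∈ ⋀[ℝ]^k M) :
    ExteriorAlgebra.map f x ∈ ⋀[ℝ]^k N := by
  have h : (⋀[ℝ]^k M).map (ExteriorAlgebra.map f).toLinearMap ≤ ⋀[ℝ]^k N := by
    rw [ExteriorAlgebra.exteriorPower, Submodule.map_pow]
    refine pow_le_pow_left' ?_ k
    rintro _ ⟨_, ⟨m, rfl⟩, rfl⟩
    exact ⟨f m, by simp⟩
  exact h ⟨x, hx, rfl⟩

lemma one_mem_exteriorPower_zero {M : Type} [AddCommGroup M] [Module ℝ M] :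
    (1 : ExteriorAlgebra ℝ M) ∈ ⋀[ℝ]^0 M := by
  rw [ExteriorAlgebra.exteriorPower, pow_zero]; exact Submodule.one_le.1 le_rfl

/-- The algebra homomorphism `L^* ⊗ ⋀ N`. -/
def biMap (L : T →ₗ[ℝ] T') (N : Z q →ₗ[ℝ] Z q) : BiForms T' q →ₐ[ℝ] BiForms T q :=
  GradedTensorProduct.lift (R := ℝ) (fun i : ℕ => ⋀[ℝ]^i (Module.Dual ℝ T'))
    (fun j : ℕ => ⋀[ℝ]^j (Z q))
    ((GradedTensorProduct.includeLeft (fun i : ℕ => ⋀[ℝ]^i (Module.Dual ℝ T))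
      (fun j : ℕ => ⋀[ℝ]^j (Z q))).comp (pullbackLin L))
    ((GradedTensorProduct.includeRight (fun i : ℕ => ⋀[ℝ]^i (Module.Dual ℝ T))
      (fun j : ℕ => ⋀[ℝ]^j (Z q))).comp (ExteriorAlgebra.map N))
    (by
      intro i j a b
      have ha : pullbackLin L a ∈ ⋀[ℝ]^i (Module.Dual ℝ T) := map_mem_exteriorPower _ a.2
      have hb := map_mem_exteriorPower N b.2
      have h1 := biTmul_mul_biTmul (pullbackLin L a) (j := 0) (k := 0)
        (one_mem_exteriorPower_zero (M := Z q)) one_mem_exteriorPower_zero (ExteriorAlgebra.map N b)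
      have h2 := biTmul_mul_biTmul (1 : Forms T) hb ha 1
      rw [mul_zero, pow_zero, one_smul, one_mul, mul_one] at h1
      rw [one_mul, mul_one] at h2
      refine h1.trans ?_
      -- The graded product in the opposite order contributes a second copy of the sign required by
      -- the lift, and the two cancel.
      refine Eq.trans ?_ (congrArg (fun x => (-1 : ℤˣ) ^ (j * i) • x) h2.symm)
      rw [neg_one_units_pow_smul, smul_smul, ← mul_pow]
      norm_num)

lemma biMap_biTmul (L : T →ₗ[ℝ] T') (N : Z q →ₗ[ℝ] Z q) (ω : Forms T')
    (s : ExteriorAlgebra ℝ (Z q)) :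
    biMap L N (biTmul ω s) = biTmul (pullbackLin L ω) (ExteriorAlgebra.map N s) := by
  have h := biTmul_mul_biTmul (pullbackLin L ω) (j := 0) (k := 0)
    (one_mem_exteriorPower_zero (M := Z q)) one_mem_exteriorPower_zero (ExteriorAlgebra.map N s)
  rw [mul_zero, pow_zero, one_smul, one_mul, mul_one] at h
  exact h

lemma biMap_gen (L : T →ₗ[ℝ] T') (N : Z q →ₗ[ℝ] Z q) (a : Module.Dual ℝ T') (z : Z q) :
    biMap L N (gen a z) = gen (a ∘ₗ L) (N z) := by
  rw [gen, biMap_biTmul, pullbackLin, ExteriorAlgebra.map_apply_ι, ExteriorAlgebra.map_apply_ι]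
  rfl

/-- `vectorForm` is the basis-free identification of linear maps with tensors in `T* ⊗ z₀`, hence
natural in both variables; the proof moves the matrix of `N` from the vectors to the linear forms.
-/
lemma biMap_vectorForm (L : T →ₗ[ℝ] T') (N : Z q →ₗ[ℝ] Z q) (F : T' →ₗ[ℝ] Z q) :
    biMap L N (vectorForm F) = vectorForm (N ∘ₗ F ∘ₗ L) := by
  have h1 : ∀ μ, N (Pi.single μ 1) = ∑ ν, N (Pi.single μ 1) ν • (Pi.single ν 1 : Z q) :=
    fun μ => pi_eq_sum_univ' _
  have h2 : ∀ ν, LinearMap.proj ν ∘ₗ N ∘ₗ F ∘ₗ L =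
      ∑ μ, N (Pi.single μ 1) ν • ((LinearMap.proj μ ∘ₗ F) ∘ₗ L : Module.Dual ℝ T) := by
    intro ν
    ext ξ
    have := congrFun (congrArg N (pi_eq_sum_univ' (F (L ξ)))) ν
    simpa [mul_comm] using this
  simp only [vectorForm_eq_sum_gen, map_sum, biMap_gen]
  simp_rw [h2, ← genHom_apply, map_sum, LinearMap.sum_apply]
  rw [Finset.sum_comm]
  refine Finset.sum_congr rfl fun μ _ => ?_
  conv_lhs => rw [h1 μ]
  simp

/-! ### The Berezin integral -/

lemma berezinForm_biTmul (p : ℕ) (b : Fin q → Z q) (ω : Forms T) (s : ExteriorAlgebra ℝ (Z q)) :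
    berezinForm p b (biTmul ω s) = berezin p b s • ω := rfl

lemma fiberInner_eq_sum (p : ℕ) (w w' : Z q) : fiberInner p w w' = ∑ μ, w μ * w' μ := by
  simp [fiberInner, form, incl]

lemma berezin_ιMulti (p : ℕ) (b : Fin q → Z q) (z : Fin q → Z q) :
    berezin p b (ExteriorAlgebra.ιMulti ℝ q z) =
      Matrix.det (Matrix.of fun i j => fiberInner p (z i) (b j)) := by
  rw [berezin, ExteriorAlgebra.liftAlternating_apply_ιMulti, Pi.single_eq_same]
  rfl

lemma berezin_eq_zero (p : ℕ) (b : Fin q → Z q) {j : ℕ} (hj : j ≠ q)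
    {s : ExteriorAlgebra ℝ (Z q)} (hs : s ∈ ⋀[ℝ]^j (Z q)) : berezin p b s = 0 := by
  rw [← ExteriorAlgebra.ιMulti_span_fixedDegree] at hs
  induction hs using Submodule.span_induction with
  | mem s hs =>
    obtain ⟨z, rfl⟩ := hs
    rw [berezin, ExteriorAlgebra.liftAlternating_apply_ιMulti, Pi.single_eq_of_ne hj]
    rfl
  | zero => exact map_zero _
  | add x y _ _ hx hy => rw [map_add, hx, hy, add_zero]
  | smul c x _ hx => rw [map_smul, hx, smul_zero]

/-- The top exterior power is a line on which `N` acts by its determinant; in the other degrees both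
sides vanish. -/
lemma berezin_map (p : ℕ) (b : Fin q → Z q) (N : Z q →ₗ[ℝ] Z q) (s : ExteriorAlgebra ℝ (Z q)) :
    berezin p b (ExteriorAlgebra.map N s) = LinearMap.det N * berezin p b s := by
  suffices h : berezin p b ∘ₗ (ExteriorAlgebra.map N).toLinearMap = LinearMap.det N • berezin p b from
    LinearMap.congr_fun h s
  refine ExteriorAlgebra.lhom_ext fun i => ?_
  ext z
  change berezin p b (ExteriorAlgebra.map N (ExteriorAlgebra.ιMulti ℝ i z)) =
    LinearMap.det N • berezin p b (ExteriorAlgebra.ιMulti ℝ i z)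
  by_cases hi : i = q
  · subst hi
    have key : ∀ f : Z i [⋀^Fin i]→ₗ[ℝ] ℝ, f (N ∘ z) = LinearMap.det N • f z := by
      intro f
      rw [f.eq_smul_basis_det (Pi.basisFun ℝ (Fin i)), AlternatingMap.smul_apply,
        AlternatingMap.smul_apply, Module.Basis.det_comp, smul_eq_mul, smul_eq_mul, smul_eq_mul]
      ring
    rw [ExteriorAlgebra.map_apply_ιMulti, berezin, ExteriorAlgebra.liftAlternating_apply_ιMulti,
      ExteriorAlgebra.liftAlternating_apply_ιMulti, Pi.single_eq_same]
    exact key _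
  · have h1 := ExteriorAlgebra.ιMulti_range ℝ i ⟨z, rfl⟩
    rw [berezin_eq_zero p b hi h1, berezin_eq_zero p b hi (map_mem_exteriorPower N h1), smul_zero]

lemma berezinForm_biMap (p : ℕ) (b : Fin q → Z q) (L : T →ₗ[ℝ] T') (N : Z q →ₗ[ℝ] Z q)
    (x : BiForms T' q) :
    berezinForm p b (biMap L N x) = LinearMap.det N • pullbackLin L (berezinForm p b x) := by
  induction x using BiForms.induction with
  | zero => simp
  | tmul ω s =>
    rw [biMap_biTmul, berezinForm_biTmul, berezinForm_biTmul, berezin_map, map_smul, smul_smul]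
  | add x y hx hy => simp only [map_add, hx, hy, smul_add]

/-! ### Degree and horizontality of Berezin integrals -/

/-- The sums of elements of bidegree `(k, k)` with coefficients generated by `M`. -/
def diagSpan (q : ℕ) (M : Submodule ℝ (Module.Dual ℝ T)) : Submodule ℝ (BiForms T q) :=
  Submodule.span ℝ {x | ∃ k : ℕ, ∃ ω ∈ (M.map (ExteriorAlgebra.ι ℝ)) ^ k, ∃ s ∈ ⋀[ℝ]^k (Z q),
    x = biTmul ω s}

lemma map_ι_pow_le (M : Submodule ℝ (Module.Dual ℝ T)) (k : ℕ) :
    (M.map (ExteriorAlgebra.ι ℝ)) ^ k ≤ ⋀[ℝ]^k (Module.Dual ℝ T) :=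
  pow_le_pow_left' LinearMap.map_le_range k

lemma genAlg_le_diagSpan (M : Submodule ℝ (Module.Dual ℝ T)) {x : BiForms T q}
    (hx : x ∈ genAlg q M) : x ∈ diagSpan q M := by
  induction hx using Algebra.adjoin_induction with
  | mem x hx =>
    obtain ⟨a, ha, z, rfl⟩ := hx
    exact Submodule.subset_span ⟨1, _, by rw [pow_one]; exact ⟨a, ha, rfl⟩, _,
      ι_mem_exteriorPower_one z, rfl⟩
  | algebraMap r =>
    rw [Algebra.algebraMap_eq_smul_one]
    refine Submodule.smul_mem _ _ (Submodule.subset_span ⟨0, 1, ?_, 1, ?_, biTmul_one_one.symm⟩)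
    · rw [pow_zero]; exact Submodule.one_le.1 le_rfl
    · rw [ExteriorAlgebra.exteriorPower, pow_zero]; exact Submodule.one_le.1 le_rfl
  | add x y _ _ hx hy => exact add_mem hx hy
  | mul x y hx' hy' hx hy =>
    clear hx' hy'
    induction hx, hy using Submodule.span_induction₂ with
    | mem_mem x y hx hy =>
      obtain ⟨j, ω, hω, s, hs, rfl⟩ := hx
      obtain ⟨k, η, hη, t, ht, rfl⟩ := hy
      rw [biTmul_mul_biTmul _ hs (map_ι_pow_le M k hη)]
      refine Submodule.smul_mem _ _ (Submodule.subset_span ⟨j + k, _, ?_, _, ?_, rfl⟩)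
      · rw [pow_add]; exact Submodule.mul_mem_mul hω hη
      · rw [ExteriorAlgebra.exteriorPower, pow_add]; exact Submodule.mul_mem_mul hs ht
    | zero_left y _ => rw [zero_mul]; exact zero_mem _
    | zero_right x _ => rw [mul_zero]; exact zero_mem _
    | add_left x y z _ _ _ h h' => rw [add_mul]; exact add_mem h h'
    | add_right x y z _ _ _ h h' => rw [mul_add]; exact add_mem h h'
    | smul_left r x y _ _ h => rw [smul_mul_assoc]; exact Submodule.smul_mem _ _ h
    | smul_right r x y _ _ h => rw [mul_smul_comm]; exact Submodule.smul_mem _ _ h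

/-- The integral selects degree `q` in `⋀ z₀`, and equality of the two degrees then forces degree
`q` in the forms. `M = ⊤` gives the degree condition; taking for `M` the 1-forms that kill a
vertical vector gives horizontality. -/
lemma berezinForm_mem (p : ℕ) (b : Fin q → Z q) {M : Submodule ℝ (Module.Dual ℝ T)}
    {x : BiForms T q} (hx : x ∈ genAlg q M) :
    berezinForm p b x ∈ (M.map (ExteriorAlgebra.ι ℝ)) ^ q := by
  have h := genAlg_le_diagSpan M hx
  clear hx
  induction h using Submodule.span_induction with
  | mem x hx =>
    obtain ⟨k, ω, hω, s, hs, rfl⟩ := hx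
    rw [berezinForm_biTmul]
    by_cases hk : k = q
    · subst hk; exact Submodule.smul_mem _ _ hω
    · rw [berezin_eq_zero p b hk hs, zero_smul]; exact zero_mem _
  | zero => rw [map_zero]; exact zero_mem _
  | add x y _ _ hx hy => rw [map_add]; exact add_mem hx hy
  | smul c x _ hx => rw [map_smul]; exact Submodule.smul_mem _ _ hx

/-- The interior product is an antiderivation that vanishes on the generators in `M`. -/
lemma interior_eq_zero {ξ : T} {M : Submodule ℝ (Module.Dual ℝ T)} (h : ∀ a ∈ M, a ξ = 0) {k : ℕ}
    {ω : Forms T} (hω : ω ∈ (M.map (ExteriorAlgebra.ι ℝ)) ^ k) : interior ξ ω = 0 := by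
  induction hω using Submodule.pow_induction_on_left' with
  | algebraMap r => exact CliffordAlgebra.contractLeft_algebraMap _ _ r
  | add x y i hx hy h1 h2 => rw [map_add, h1, h2, add_zero]
  | mem_mul m hm i x hx ih =>
    obtain ⟨a, ha, rfl⟩ := hm
    refine (CliffordAlgebra.contractLeft_ι_mul (Module.Dual.eval ℝ T ξ) a x).trans ?_
    change a ξ • x - _ * interior ξ x = 0
    rw [h a ha, ih, zero_smul, mul_zero, sub_zero]

/-! ### Two-forms -/

/-- The antisymmetrized product gives `a ∧ b` twice in the full double sum, which the factor `1/2`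
in `twoForm` corrects. -/
lemma twoForm_sum [FiniteDimensional ℝ T] {ι : Type} (s : Finset ι) (a b : ι → Module.Dual ℝ T) :
    (twoForm fun ξ η => ∑ i ∈ s, (a i ξ * b i η - b i ξ * a i η)) =
      ∑ i ∈ s, ExteriorAlgebra.ι ℝ (a i) * ExteriorAlgebra.ι ℝ (b i) := by
  have h : ∀ f g : Module.Dual ℝ T, ∑ k, ∑ l,
      (f (Module.finBasis ℝ T k) * g (Module.finBasis ℝ T l)) •
        (ExteriorAlgebra.ι ℝ ((Module.finBasis ℝ T).coord k) *
          ExteriorAlgebra.ι ℝ ((Module.finBasis ℝ T).coord l)) =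
      ExteriorAlgebra.ι ℝ f * ExteriorAlgebra.ι ℝ g := by
    intro f g
    conv_rhs => rw [← (Module.finBasis ℝ T).sum_dual_apply_smul_coord f,
      ← (Module.finBasis ℝ T).sum_dual_apply_smul_coord g]
    simp only [map_sum, map_smul, Finset.sum_mul_sum, smul_mul_smul_comm]
  have h' : ∀ i, ∑ k, ∑ l, (a i (Module.finBasis ℝ T k) * b i (Module.finBasis ℝ T l) -
        b i (Module.finBasis ℝ T k) * a i (Module.finBasis ℝ T l)) •
        (ExteriorAlgebra.ι ℝ ((Module.finBasis ℝ T).coord k) *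
          ExteriorAlgebra.ι ℝ ((Module.finBasis ℝ T).coord l)) =
      (2 : ℝ) • (ExteriorAlgebra.ι ℝ (a i) * ExteriorAlgebra.ι ℝ (b i)) := by
    intro i
    simp only [sub_smul, Finset.sum_sub_distrib, h]
    rw [ι_mul_ι_swap (b i), sub_neg_eq_add, two_smul]
  rw [twoForm]
  simp only [Finset.sum_smul]
  rw [show ∀ x y : Forms T, (1 / 2 : ℝ) • x = y ↔ x = (2 : ℝ) • y from fun x y => by
    constructor
    · rintro rfl; rw [smul_smul]; norm_num
    · rintro rfl; rw [smul_smul]; norm_num]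
  rw [Finset.smul_sum, Finset.sum_congr rfl fun k _ => Finset.sum_comm, Finset.sum_comm]
  exact Finset.sum_congr rfl fun i _ => h' i

end BiForms

/-! ## Matrix computations in the group and its Lie algebra -/

section Group

variable {p q : ℕ}

lemma act_apply (g : Gplus p q) (v : V p q) : act g v = (mat g).mulVec v := rfl

lemma pr_incl (w : Z q) : pr p q (incl p q w) = w := rfl

lemma incl_injective : Function.Injective (incl p q) := fun w w' h => by
  rw [← pr_incl (p := p) w, h, pr_incl]

lemma rho_apply (g : Gplus p q) (w : Z q) : rho g w = pr p q (act g (incl p q w)) := rfl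

lemma rho_pr (k : Gplus p q) (hk : k ∈ K p q) (u : V p q) :
    rho k (pr p q u) = pr p q (act k u) := by
  rw [rho_apply, act_incl_pr k hk, pr_incl]

lemma incl_rho (k : Gplus p q) (hk : k ∈ K p q) (w : Z q) :
    incl p q (rho k w) = act k (incl p q w) := by
  rw [rho_apply, ← act_incl_pr k hk, pr_incl]

lemma rho_rho_inv (k : Gplus p q) (hk : k ∈ K p q) (w : Z q) : rho k (rho k⁻¹ w) = w := by
  rw [rho_apply, incl_rho _ (inv_mem hk), act_act_inv, pr_incl]

lemma fiberInner_rho (k : Gplus p q) (hk : k ∈ K p q) (w w' : Z q) :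
    fiberInner p (rho k w) (rho k w') = fiberInner p w w' := by
  rw [fiberInner, incl_rho k hk, incl_rho k hk, form_act, fiberInner]

/-- The linear map `A ↦ pr(A u)` on `𝔤`, depending linearly on `u`. -/
def prAct (p q : ℕ) : V p q →ₗ[ℝ] LieG p q →ₗ[ℝ] Z q :=
  LinearMap.mk₂ ℝ (fun u X => pr p q (X.1.mulVec u))
    (fun u u' X => by simp [Matrix.mulVec_add])
    (fun c u X => by simp [Matrix.mulVec_smul])
    (fun u X Y => by simp [Matrix.add_mulVec])
    (fun c u X => by simp [Matrix.smul_mulVec])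

lemma prAct_apply (u : V p q) (A : LieG p q) : prAct p q u A = pr p q (A.1.mulVec u) := rfl

lemma rhoLie_apply (A : LieG p q) (w : Z q) : rhoLie p q A w = prAct p q (incl p q w) A := rfl

/-- The positive basis vector `e_α`. -/
def ePos (p q : ℕ) (α : Fin p) : V p q := Pi.single (Sum.inl α) 1

/-- The component of `u` orthogonal to `z₀`. -/
def posPart (p q : ℕ) : V p q →ₗ[ℝ] V p q := LinearMap.id - incl p q ∘ₗ pr p q

lemma posPart_apply (u : V p q) : posPart p q u = u - incl p q (pr p q u) := rfl

lemma posPart_eq_sum (u : V p q) : posPart p q u = ∑ α, u (Sum.inl α) • ePos p q α := by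
  ext (i | i)
  · simp [posPart_apply, incl, ePos, Finset.sum_apply, Pi.single_apply]
  · simp [posPart_apply, incl, ePos, pr, Finset.sum_apply]

lemma posPart_ePos (α : Fin p) : posPart p q (ePos p q α) = ePos p q α := by
  ext (i | i) <;> simp [posPart_apply, incl, ePos, pr]

lemma act_posPart (k : Gplus p q) (hk : k ∈ K p q) (u : V p q) :
    act k (posPart p q u) = posPart p q (act k u) := by
  rw [posPart_apply, map_sub, act_incl_pr k hk, posPart_apply]

lemma LieG_apply_inr_inl (A : LieG p q) (μ : Fin q) (α : Fin p) :
    A.1 (Sum.inr μ) (Sum.inl α) = A.1 (Sum.inl α) (Sum.inr μ) := by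
  have h := congrFun (congrFun ((mem_LieG_iff A.1).1 A.2) (Sum.inl α)) (Sum.inr μ)
  simpa [gram] using h

lemma prAct_ePos (α : Fin p) (A : LieG p q) (μ : Fin q) :
    prAct p q (ePos p q α) A μ = A.1 (Sum.inl α) (Sum.inr μ) := by
  rw [← LieG_apply_inr_inl]
  simp [prAct_apply, pr, ePos]

lemma omega_apply (α : Fin p) (μ : Fin q) (A : LieG p q) :
    omega α μ A = A.1 (Sum.inl α) (Sum.inr μ) := rfl

lemma proj_comp_prAct_ePos (α : Fin p) (μ : Fin q) :
    LinearMap.proj μ ∘ₗ prAct p q (ePos p q α) = omega α μ :=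
  LinearMap.ext fun A => prAct_ePos α A μ

/-- Only the lower right block acts from `z₀` to `z₀`, and `projK` keeps it; so in `∇̃𝐬` the
connection form may be replaced by the whole Maurer–Cartan form. -/
lemma prAct_incl_projK (w : Z q) (A : LieG p q) :
    prAct p q (incl p q w) (projK p q A) = prAct p q (incl p q w) A := by
  ext μ
  simp [prAct_apply, pr, incl, projK, Matrix.mulVec, dotProduct, Matrix.toBlocks₂₂]

lemma prAct_posPart_of_mem_LieK (u : V p q) {X : LieG p q} (hX : X ∈ LieK p q) :
    prAct p q (posPart p q u) X = 0 := by
  obtain ⟨A, rfl⟩ := hX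
  ext μ
  simp [prAct_apply, posPart_apply, pr, incl, projK, Matrix.mulVec, dotProduct]

lemma Ad_mulVec (g : Gplus p q) (A : LieG p q) (u : V p q) :
    (Ad g A).1.mulVec u = act g (A.1.mulVec (act g⁻¹ u)) := by
  change (mat g * A.1 * mat g⁻¹).mulVec u = _
  rw [← Matrix.mulVec_mulVec, ← Matrix.mulVec_mulVec]
  rfl

/-- This is the source of all the `K`-equivariance below: `k` commutes with the projection and `Ad
k⁻¹` conjugates it away. -/
lemma rho_prAct_Ad (k : Gplus p q) (hk : k ∈ K p q) (u : V p q) (A : LieG p q) :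
    rho k (prAct p q u (Ad k⁻¹ A)) = prAct p q (act k u) A := by
  rw [prAct_apply, Ad_mulVec, rho_pr k hk, act_act_inv, inv_inv, prAct_apply]

lemma transpose_mat_mul_gram_mul (g : Gplus p q) :
    (mat g).transpose * gram p q * mat g = gram p q := by
  ext i j
  have h := form_act g (Pi.single i 1) (Pi.single j 1)
  rw [form_eq_dotProduct, form_eq_dotProduct, act_apply, act_apply, Matrix.mulVec_mulVec,
    Matrix.dotProduct_mulVec, Matrix.vecMul_mulVec, ← Matrix.dotProduct_mulVec] at h
  simpa [mul_assoc] using h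

/-- Makes `g⁻¹ v` linear in the entries of `g`, whence smoothness. -/
lemma mat_inv (g : Gplus p q) : mat g⁻¹ = gram p q * (mat g).transpose * gram p q := by
  have h1 : mat g * mat g⁻¹ = 1 := by rw [← mat_mul, mul_inv_cancel, mat_one]
  calc mat g⁻¹ = gram p q * (gram p q) * mat g⁻¹ := by rw [gram_mul_gram, one_mul]
    _ = gram p q * ((mat g).transpose * gram p q * mat g) * mat g⁻¹ := by
      rw [transpose_mat_mul_gram_mul]
    _ = gram p q * (mat g).transpose * gram p q * (mat g * mat g⁻¹) := by simp only [mul_assoc]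
    _ = _ := by rw [h1, mul_one]

lemma mat_mul_gram_mul_transpose (g : Gplus p q) :
    mat g * gram p q * (mat g).transpose = gram p q := by
  have h1 : mat g * mat g⁻¹ = 1 := by rw [← mat_mul, mul_inv_cancel, mat_one]
  rw [mat_inv, ← mul_assoc, ← mul_assoc] at h1
  rw [← mul_one (mat g * gram p q * (mat g).transpose), ← gram_mul_gram, ← mul_assoc, h1, one_mul]

lemma mat_inr_inl (k : Gplus p q) (hk : k ∈ K p q) (μ : Fin q) (α : Fin p) :
    mat k (Sum.inr μ) (Sum.inl α) = 0 := by
  have h := congrFun (rho_pr k hk (ePos p q α)) μ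
  have h0 : pr p q (ePos p q α) = 0 := by ext; simp [pr, ePos]
  rw [h0, map_zero] at h
  simpa [pr, act_apply, ePos] using h.symm

lemma mat_inl_inr (k : Gplus p q) (hk : k ∈ K p q) (α : Fin p) (μ : Fin q) :
    mat k (Sum.inl α) (Sum.inr μ) = 0 := by
  have h := congrFun (incl_rho k hk (Pi.single μ 1)) (Sum.inl α)
  have h0 : incl p q (Pi.single μ 1) = Pi.single (Sum.inr μ) 1 := by
    ext (i | i) <;> simp [incl, Pi.single_apply]
  rw [h0] at h
  simpa [incl, act_apply] using h.symm

lemma sum_mat_inl_mul_mat_inl (k : Gplus p q) (hk : k ∈ K p q) (β γ : Fin p) :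
    ∑ α, mat k (Sum.inl β) (Sum.inl α) * mat k (Sum.inl γ) (Sum.inl α) =
      if β = γ then 1 else 0 := by
  have h := congrFun (congrFun (mat_mul_gram_mul_transpose k) (Sum.inl β)) (Sum.inl γ)
  simpa [gram, Matrix.mul_apply, Matrix.mul_diagonal, Fintype.sum_sum_type, mat_inl_inr k hk,
    Matrix.diagonal_apply] using h

lemma toBlocks₂₂_mul_transpose (k : Gplus p q) (hk : k ∈ K p q) :
    (mat k).toBlocks₂₂ * (mat k).toBlocks₂₂.transpose = 1 := by
  ext μ ν
  have h := congrFun (congrFun (mat_mul_gram_mul_transpose k) (Sum.inr μ)) (Sum.inr ν)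
  simp only [gram, Matrix.mul_apply, Fintype.sum_sum_type, mat_inr_inl k hk, Matrix.diagonal_apply,
    Matrix.transpose_apply] at h
  simp only [Matrix.mul_apply, Matrix.toBlocks₂₂, Matrix.transpose_apply, Matrix.of_apply,
    Matrix.one_apply]
  by_cases e : μ = ν <;> simp [e] at h ⊢ <;> linarith

lemma act_ePos (k : Gplus p q) (hk : k ∈ K p q) (α : Fin p) :
    act k (ePos p q α) = ∑ β, mat k (Sum.inl β) (Sum.inl α) • ePos p q β := by
  conv_lhs => rw [← posPart_ePos, act_posPart k hk, posPart_eq_sum]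
  simp [act_apply, ePos]

/-! ### Orientation of the negative directions -/

/-- A nonzero kernel vector `w` would have `Q(w,w) < 0` while `g w` has no negative coordinates, so
`Q(gw,gw) ≥ 0`. -/
lemma det_toBlocks₂₂_ne_zero (g : orthogonalGroup p q) : g.1.1.toBlocks₂₂.det ≠ 0 := by
  intro h
  obtain ⟨w, hw, h0⟩ := Matrix.exists_mulVec_eq_zero_iff.2 h
  have h1 := g.2 (incl p q w) (incl p q w)
  have h2 : ∀ μ, g.1.1.mulVec (incl p q w) (Sum.inr μ) = 0 := by
    intro μ
    rw [← show g.1.1.toBlocks₂₂.mulVec w μ = 0 from congrFun h0 μ]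
    simp [Matrix.mulVec, dotProduct, incl, Matrix.toBlocks₂₂]
  have h3 : form (incl p q w) (incl p q w) = -∑ μ, w μ ^ 2 := by simp [form, incl, pow_two]
  rw [h3, form] at h1
  simp only [h2, mul_zero, Finset.sum_const_zero, sub_zero] at h1
  simp only [← pow_two] at h1
  have h4 : 0 ≤ ∑ α, (g.1.1.mulVec (incl p q w) (Sum.inl α)) ^ 2 :=
    Finset.sum_nonneg fun _ _ => sq_nonneg _
  have h5 : ∑ μ, w μ ^ 2 = 0 :=
    le_antisymm (by linarith) (Finset.sum_nonneg fun _ _ => sq_nonneg _)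
  rw [Finset.sum_eq_zero_iff_of_nonneg fun _ _ => sq_nonneg _] at h5
  exact hw (funext fun μ => by simpa using h5 μ (Finset.mem_univ μ))

/-- By connectedness `G(ℝ)⁺` preserves the orientation of the negative directions. -/
lemma det_toBlocks₂₂_pos (g : Gplus p q) : 0 < (mat g).toBlocks₂₂.det := by
  have hc : Continuous fun g : orthogonalGroup p q => g.1.1.toBlocks₂₂.det := by
    refine Continuous.matrix_det ?_
    refine continuous_matrix fun i j => ?_
    exact (Units.continuous_val.comp continuous_subtype_val).matrix_elem _ _
  have hi := (isPreconnected_connectedComponent (x := (1 : orthogonalGroup p q))).image _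
    hc.continuousOn
  by_contra hneg
  have h0 : (0 : ℝ) ∈ (fun g : orthogonalGroup p q => g.1.1.toBlocks₂₂.det) ''
      connectedComponent 1 := by
    refine hi.Icc_subset ⟨g.1, g.2, rfl⟩ ⟨1, mem_connectedComponent, rfl⟩ ⟨not_lt.1 hneg, ?_⟩
    have : (1 : Matrix (Fin p ⊕ Fin q) (Fin p ⊕ Fin q) ℝ).toBlocks₂₂ = 1 := by
      ext i j; simp [Matrix.toBlocks₂₂, Matrix.one_apply]
    simp [this]
  obtain ⟨x, -, hx⟩ := h0
  exact det_toBlocks₂₂_ne_zero x hx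

/-- The lower right block of `k` is orthogonal, so its determinant is `±1`; connectedness excludes
`-1`. -/
lemma det_rho (k : Gplus p q) (hk : k ∈ K p q) : LinearMap.det (rho k) = 1 := by
  have h1 : rho k = Matrix.toLin' (mat k).toBlocks₂₂ := by
    refine LinearMap.ext fun w => funext fun μ => ?_
    simp [rho, pr, incl, act_apply, Matrix.mulVec, dotProduct, Matrix.toBlocks₂₂]
  have h2 := congrArg Matrix.det (toBlocks₂₂_mul_transpose k hk)
  rw [Matrix.det_mul, Matrix.det_transpose, Matrix.det_one] at h2
  rw [h1, LinearMap.det_toLin']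
  nlinarith [det_toBlocks₂₂_pos k]

/-! ## The ingredients of the Mathai–Quillen form -/

lemma differential_eq {P T : Type} [AddCommGroup T] [Module ℝ T] (curve : P → T → ℝ → P)
    (f : P → Z q) (x : P) (L : T →ₗ[ℝ] Z q)
    (h : ∀ ξ : T, HasDerivAt (fun t : ℝ => f (curve x ξ t)) (L ξ) 0) :
    differential curve f x = L := by
  have h' : ∃ L : T →ₗ[ℝ] Z q, ∀ ξ : T, HasDerivAt (fun t : ℝ => f (curve x ξ t)) (L ξ) 0 := ⟨L, h⟩
  rw [differential, dif_pos h']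
  exact LinearMap.ext fun ξ => (h'.choose_spec ξ).unique (h ξ)

lemma covariantDerivative_tautological (x : Gplus p q × Z q) (ξ : LieG p q × Z q) :
    covariantDerivative tautological x ξ = ξ.2 + prAct p q (incl p q x.2) ξ.1 := by
  have h : differential curveE tautological x = LinearMap.snd ℝ (LieG p q) (Z q) := by
    refine differential_eq _ _ _ _ fun ξ => ?_
    change HasDerivAt (fun t : ℝ => x.2 + t • ξ.2) ξ.2 0
    simpa using ((hasDerivAt_id (0 : ℝ)).smul_const ξ.2).const_add x.2
  rw [covariantDerivative, h]
  change ξ.2 + prAct p q (incl p q x.2) (projK p q ξ.1) = _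
  rw [prAct_incl_projK]

/-- The brackets of the `𝔨`-parts cancel between the two terms of the curvature; what remains is
minus the bracket of the `𝔭`-parts, a sum over the positive indices. -/
lemma fiberInner_curvature (ξ η : LieG p q × Z q) (μ ν : Fin q) :
    fiberInner p (rhoLie p q (curvature ξ η) (Pi.single μ 1)) (Pi.single ν 1) =
      ∑ α, (omega α μ ξ.1 * omega α ν η.1 - omega α ν ξ.1 * omega α μ η.1) := by
  have h0 : incl p q (Pi.single μ 1) = Pi.single (Sum.inr μ) 1 := by
    ext (i | i) <;> simp [incl, Pi.single_apply]
  have h1 : fiberInner p (rhoLie p q (curvature ξ η) (Pi.single μ 1)) (Pi.single ν 1) =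
      (curvature ξ η).1 (Sum.inr ν) (Sum.inr μ) := by
    rw [fiberInner_eq_sum, rhoLie_apply, prAct_apply, h0]
    simp [pr, Pi.single_apply]
  rw [h1]
  have e1 := LieG_apply_inr_inl ξ.1
  have e2 := LieG_apply_inr_inl η.1
  simp only [curvature, bracket, connection, projK, omega_apply, LinearMap.comp_apply, LinearMap.fst_apply,
    LinearMap.coe_mk, AddHom.coe_mk, Submodule.coe_sub, Matrix.sub_apply, Matrix.mul_apply,
    Fintype.sum_sum_type, Matrix.fromBlocks_apply₂₂, Matrix.fromBlocks_apply₂₁,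
    Matrix.fromBlocks_apply₁₂, Matrix.toBlocks₂₂, Matrix.of_apply, Matrix.zero_apply, zero_mul,
    Finset.sum_const_zero, zero_add, e1, e2, Finset.sum_sub_distrib]
  rw [Finset.sum_congr rfl fun α _ => mul_comm (η.1.1 (Sum.inl α) (Sum.inr ν)) _]
  ring

/-- The diagonal terms vanish, each pair `μ < ν` occurs twice, and the graded product contributes
the minus sign. -/
lemma vectorForm_sq {T : Type} [AddCommGroup T] [Module ℝ T] (L : T →ₗ[ℝ] Z q) :
    vectorForm L ^ 2 = (-2 : ℝ) • ∑ μ : Fin q, ∑ ν ∈ Finset.Ioi μ,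
      biTmul (ExteriorAlgebra.ι ℝ (LinearMap.proj μ ∘ₗ L) *
        ExteriorAlgebra.ι ℝ (LinearMap.proj ν ∘ₗ L)) (eVec μ * eVec ν) := by
  set f : Fin q → Fin q → BiForms T q := fun μ ν =>
    gen (LinearMap.proj μ ∘ₗ L) (Pi.single μ 1 : Z q) *
      gen (LinearMap.proj ν ∘ₗ L) (Pi.single ν 1 : Z q) with hf
  have h1 : vectorForm L ^ 2 = ∑ ν, ∑ μ, f μ ν := by
    rw [pow_two, vectorForm_eq_sum_gen, Finset.sum_mul_sum, Finset.sum_comm]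
  have h2 : ∀ ν, ∑ μ, f μ ν = ∑ μ ∈ {ν}ᶜ, f μ ν := by
    intro ν
    rw [← Finset.sum_add_sum_compl {ν}, Finset.sum_singleton, hf]
    simp only [gen_mul_gen_self_right, zero_add]
  rw [h1, Finset.sum_congr rfl fun ν _ => h2 ν, ← Finset.sum_sum_Ioi_add_eq_sum_sum_off_diag,
    Finset.smul_sum]
  refine Finset.sum_congr rfl fun μ _ => ?_
  rw [Finset.smul_sum]
  refine Finset.sum_congr rfl fun ν _ => ?_
  rw [hf]
  dsimp only
  rw [(gen_commute _ _ _ _).eq, gen_mul_gen, ← two_smul ℝ, smul_neg, neg_smul]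
  rfl

/-- The linear map `(A, u) ↦ pr(A x)` on `𝔤 × z₀`. -/
def prActFst (p q : ℕ) (x : V p q) : LieG p q × Z q →ₗ[ℝ] Z q :=
  prAct p q x ∘ₗ LinearMap.fst ℝ (LieG p q) (Z q)

/-- Each coefficient of the curvature is `∑_α ω_{αμ} ∧ ω_{αν}`, the coefficient that appears in the
squares. The curvature thereby becomes the quadratic term of a Hermite generating function. -/
lemma curvatureForm_eq (p q : ℕ) : curvatureForm p q =
    (-(1 / 2) : ℝ) • ∑ α, vectorForm (prActFst p q (ePos p q α)) ^ 2 := by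
  have h : ∀ μ ν : Fin q, (twoForm fun ξ η : LieG p q × Z q => fiberInner p
      (rhoLie p q (curvature ξ η) (Pi.single μ 1)) (Pi.single ν 1)) =
      ∑ α, ExteriorAlgebra.ι ℝ (LinearMap.proj μ ∘ₗ prActFst p q (ePos p q α)) *
        ExteriorAlgebra.ι ℝ (LinearMap.proj ν ∘ₗ prActFst p q (ePos p q α)) := by
    intro μ ν
    simp only [fiberInner_curvature, prActFst, ← LinearMap.comp_assoc, proj_comp_prAct_ePos]
    exact twoForm_sum Finset.univ (fun α => omega α μ ∘ₗ LinearMap.fst ℝ (LieG p q) (Z q))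
      (fun α => omega α ν ∘ₗ LinearMap.fst ℝ (LieG p q) (Z q))
  simp only [curvatureForm, h, vectorForm_sq, ← Finset.smul_sum, smul_smul]
  norm_num
  rw [Finset.sum_comm]
  refine Finset.sum_congr rfl fun μ _ => ?_
  rw [Finset.sum_comm]
  refine Finset.sum_congr rfl fun ν _ => ?_
  simp only [← biTmulHom_apply, map_sum, LinearMap.sum_apply]

end Group

section MathaiQuillen

variable {p q : ℕ}

/-! ## The Mathai–Quillen form is a form on `E` -/

lemma sum_sq_isNilpotent {T : Type} [AddCommGroup T] [Module ℝ T] {ι : Type} (s : Finset ι)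
    (L : ι → T →ₗ[ℝ] Z q) (c : ℝ) : IsNilpotent (c • ∑ i ∈ s, vectorForm (L i) ^ 2) := by
  refine IsNilpotent.smul (Commute.isNilpotent_sum (fun i _ => ?_) fun i j _ _ => ?_) c
  · exact (vectorForm_isNilpotent _).pow_of_pos two_ne_zero
  · exact (vectorForm_commute _ _).pow_pow 2 2

/-- The elements `c L + r ∑ Lᵢ²`, with `L` and the `Lᵢ` of bidegree `(1, 1)`, are nilpotent of
bounded order. -/
lemma exists_pow_eq_zero {T : Type} [AddCommGroup T] [Module ℝ T] {ι : Type} (s : Finset ι)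
    (L : ι → T →ₗ[ℝ] Z q) (r : ℝ) : ∃ N : ℕ, ∀ (c : ℝ) (F : T →ₗ[ℝ] Z q),
      (c • vectorForm F + r • ∑ i ∈ s, vectorForm (L i) ^ 2) ^ N = 0 := by
  obtain ⟨n, hn⟩ := sum_sq_isNilpotent s L r
  refine ⟨q + 1 + n - 1, fun c F => ?_⟩
  refine Commute.add_pow_add_eq_zero_of_pow_eq_zero ?_ ?_ hn
  · refine Commute.smul_left (Commute.smul_right (Commute.sum_right _ _ _ fun i _ => ?_) _) _
    exact (vectorForm_commute _ _).pow_right 2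
  · rw [smul_pow, vectorForm_pow_eq_zero, smul_zero]

/-- The nilpotent part of the exponent of `U_MQ`. -/
def mqExponent (p q : ℕ) (x : Gplus p q × Z q) : BiForms (LieG p q × Z q) q :=
  (-(2 * Real.sqrt Real.pi)) • vectorForm (covariantDerivative tautological x) +
    (-(1 / 2) : ℝ) • ∑ α, vectorForm (prActFst p q (ePos p q α)) ^ 2

lemma mqExponent_isNilpotent (x : Gplus p q × Z q) : IsNilpotent (mqExponent p q x) := by
  obtain ⟨N, hN⟩ := exists_pow_eq_zero Finset.univ (fun α => prActFst p q (ePos p q α)) (-(1 / 2))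
  exact ⟨N, hN _ _⟩

/-- The normalizing constant of `U_MQ`. -/
def mqConst (q : ℕ) : ℝ := (-1 : ℝ) ^ (q * (q + 1) / 2) * (2 * Real.pi) ^ (-(q : ℝ) / 2)

lemma mathaiQuillen_eq (b : Fin q → Z q) (x : Gplus p q × Z q) :
    mathaiQuillen p q b x = (mqConst q * Real.exp (-(2 * Real.pi * fiberInner p x.2 x.2))) •
      berezinForm p b (nilExp (mqExponent p q x)) := by
  rw [mathaiQuillen, curvatureForm_eq, sub_add, sub_eq_add_neg, neg_sub', sub_neg_eq_add,
    ← neg_smul, ← mqExponent, algExp_smul_one_add _ (mqExponent_isNilpotent x), map_smul, smul_smul]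
  rfl

lemma mqExponent_mem_genAlg {M : Submodule ℝ (Module.Dual ℝ (LieG p q × Z q))}
    (x : Gplus p q × Z q)
    (h1 : ∀ μ, LinearMap.proj μ ∘ₗ covariantDerivative tautological x ∈ M)
    (h2 : ∀ α μ, LinearMap.proj μ ∘ₗ prActFst p q (ePos p q α) ∈ M) :
    mqExponent p q x ∈ genAlg q M :=
  add_mem (Subalgebra.smul_mem _ (vectorForm_mem_genAlg h1) _) (Subalgebra.smul_mem _
    (sum_mem fun α _ => pow_mem (vectorForm_mem_genAlg (h2 α)) 2) _)

/-- An element of `K` acts on the positive directions by an orthogonal matrix, which preserves sums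
of squares. A general `F` serves both `E` and `𝔻⁺`. -/
lemma sum_vectorForm_sq_act {T : Type} [AddCommGroup T] [Module ℝ T] (k : Gplus p q)
    (hk : k ∈ K p q) (F : V p q →ₗ[ℝ] T →ₗ[ℝ] Z q) :
    ∑ α, vectorForm (F (act k (ePos p q α))) ^ 2 = ∑ α, vectorForm (F (ePos p q α)) ^ 2 := by
  have h : ∀ α, vectorForm (F (act k (ePos p q α))) ^ 2 = ∑ β, ∑ γ,
      (mat k (Sum.inl β) (Sum.inl α) * mat k (Sum.inl γ) (Sum.inl α)) •
        (vectorForm (F (ePos p q β)) * vectorForm (F (ePos p q γ))) := by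
    intro α
    simp only [act_ePos k hk, map_sum, map_smul, ← vectorFormHom_apply, pow_two,
      Finset.sum_mul_sum, smul_mul_smul_comm]
  simp only [h]
  rw [Finset.sum_comm]
  refine Finset.sum_congr rfl fun β _ => ?_
  rw [Finset.sum_comm]
  simp only [← Finset.sum_smul, sum_mat_inl_mul_mat_inl k hk, ite_smul, one_smul, zero_smul,
    Finset.sum_ite_eq, Finset.mem_univ, if_true, pow_two]

/-- Pullback alone changes the exponent by the action of `k` on `z₀`; the map `rho k` on `⋀ z₀`
undoes this, and the Berezin integral sees only its determinant. -/
lemma biMap_mqExponent (g : Gplus p q) (w : Z q) (k : Gplus p q) (hk : k ∈ K p q) :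
    biMap (LinearMap.prodMap (Ad k⁻¹) (rho k⁻¹)) (rho k) (mqExponent p q (g * k, rho k⁻¹ w)) =
      mqExponent p q (g, w) := by
  have h1 : rho k ∘ₗ covariantDerivative tautological (g * k, rho k⁻¹ w) ∘ₗ
      LinearMap.prodMap (Ad k⁻¹) (rho k⁻¹) = covariantDerivative tautological (g, w) := by
    refine LinearMap.ext fun ξ => ?_
    simp only [LinearMap.comp_apply, covariantDerivative_tautological, LinearMap.prodMap_apply,
      map_add, rho_rho_inv k hk, rho_prAct_Ad k hk, incl_rho _ (inv_mem hk), act_act_inv]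
  have h2 : ∀ α, rho k ∘ₗ prActFst p q (ePos p q α) ∘ₗ LinearMap.prodMap (Ad k⁻¹) (rho k⁻¹) =
      prActFst p q (act k (ePos p q α)) := by
    intro α
    refine LinearMap.ext fun ξ => ?_
    exact rho_prAct_Ad k hk _ _
  rw [mqExponent, map_add, map_smul, map_smul, map_sum, biMap_vectorForm, h1, mqExponent]
  simp only [map_pow, biMap_vectorForm, h2]
  congr 2
  exact sum_vectorForm_sq_act k hk
    (LinearMap.lcomp ℝ (Z q) (LinearMap.fst ℝ (LieG p q) (Z q)) ∘ₗ prAct p q)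

/-- In the left trivialization the exponent is affine in `w` and independent of the group element,
which is therefore set to 1. -/
lemma mqExponent_mem_smoothMaps (p q : ℕ) :
    (fun y : (Fin p ⊕ Fin q → Fin p ⊕ Fin q → ℝ) × Z q => mqExponent p q (1, y.2)) ∈
      smoothMaps _ _ := by
  have h : ∀ w : Z q, covariantDerivative tautological ((1 : Gplus p q), w) =
      LinearMap.snd ℝ (LieG p q) (Z q) + ∑ μ, w μ • prActFst p q (incl p q (Pi.single μ 1)) := by
    intro w
    refine LinearMap.ext fun ξ => ?_
    rw [covariantDerivative_tautological]
    conv_lhs => rw [pi_eq_sum_univ' w]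
    simp [prActFst]
  simp only [mqExponent, h, ← vectorFormHom_apply, map_add, map_sum, map_smul]
  refine add_mem (Submodule.smul_mem _ (-(2 * Real.sqrt Real.pi)) (add_mem (const_mem_smoothMaps _)
    ?_)) (const_mem_smoothMaps _)
  have : (fun y : (Fin p ⊕ Fin q → Fin p ⊕ Fin q → ℝ) × Z q => ∑ μ, y.2 μ •
      vectorFormHom _ q (prActFst p q (incl p q (Pi.single μ 1)))) = ∑ μ, fun y => y.2 μ •
      vectorFormHom _ q (prActFst p q (incl p q (Pi.single μ 1))) := by
    ext y; rw [Finset.sum_apply]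
  rw [this]
  exact sum_mem fun μ _ => smul_mem_smoothMaps (by fun_prop) _

lemma isFormOnE_mathaiQuillen (b : Fin q → Z q) (Δ : Subgroup (Gplus p q)) :
    IsFormOnE Δ q (mathaiQuillen p q b) where
  degree x := by
    rw [mathaiQuillen_eq]
    refine Submodule.smul_mem _ _ (map_ι_pow_le ⊤ q (berezinForm_mem p b ?_))
    exact nilExp_mem (mqExponent_isNilpotent x)
      (mqExponent_mem_genAlg x (fun _ => trivial) fun _ _ => trivial)
  smooth := by
    obtain ⟨N, hN⟩ := exists_pow_eq_zero Finset.univ (fun α => prActFst p q (ePos p q α)) (-(1 / 2))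
    refine isSmooth_of_mem_smoothMaps (f := fun y =>
      (mqConst q * Real.exp (-(2 * Real.pi * fiberInner p y.2 y.2))) •
        berezinForm p b (nilExp (mqExponent p q (1, y.2)))) ?_ fun x => ?_
    · refine fun_smul_mem_smoothMaps ?_ (map_mem_smoothMaps _ (nilExp_mem_smoothMaps
        (mqExponent_mem_smoothMaps p q) (N := N) fun y => hN _ _))
      simp only [fiberInner_eq_sum]
      fun_prop
    · rw [mathaiQuillen_eq]
      have : mqExponent p q (1, x.2) = mqExponent p q x := by
        have h : covariantDerivative tautological ((1 : Gplus p q), x.2) =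
            covariantDerivative tautological x := LinearMap.ext fun ξ => by
          rw [covariantDerivative_tautological, covariantDerivative_tautological]
        rw [mqExponent, h, mqExponent]
      rw [this]
  horizontal g w X hX := by
    rw [mathaiQuillen_eq, map_smul]
    -- On the vertical vector `(X, -X w)` the form `∇̃𝐬` vanishes, and so do the `ω_{αμ}`, because
    -- `X` has no mixed block.
    refine (congrArg _ (interior_eq_zero
      (M := LinearMap.ker (Module.Dual.eval ℝ _ (X, -rhoLie p q X w))) (fun a ha => ha)
      (berezinForm_mem p b (nilExp_mem (mqExponent_isNilpotent _) (mqExponent_mem_genAlg _ ?_ ?_)))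
      )).trans (smul_zero _)
    · intro μ
      rw [LinearMap.mem_ker, Module.Dual.eval_apply, LinearMap.comp_apply,
        covariantDerivative_tautological, rhoLie_apply, neg_add_cancel, map_zero]
    · intro α μ
      rw [LinearMap.mem_ker, Module.Dual.eval_apply, LinearMap.comp_apply, ← posPart_ePos]
      exact congrFun (prAct_posPart_of_mem_LieK _ hX) μ
  invariant g w k hk := by
    rw [mathaiQuillen_eq, mathaiQuillen_eq, map_smul, fiberInner_rho _ (inv_mem hk),
      ← biMap_mqExponent g w k hk, ← map_nilExp _ (mqExponent_isNilpotent _), berezinForm_biMap,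
      det_rho k hk, one_smul]
  leftInvariant δ _ g w := by
    have h : covariantDerivative tautological (δ * g, w) = covariantDerivative tautological (g, w) :=
      LinearMap.ext fun ξ => by
        rw [covariantDerivative_tautological, covariantDerivative_tautological]
    rw [mathaiQuillen_eq, mathaiQuillen_eq, mqExponent, h, mqExponent]

end MathaiQuillen

section Pullback

variable {p q : ℕ}

/-! ## The pullback of the Mathai–Quillen form by `s_v` -/

/-- Two representatives with the same `g` differ by `k = 1`. Hence the inverse function in
`sectionMap` is a genuine left inverse. -/
lemma E.mk_injective (g : Gplus p q) : Function.Injective fun w : Z q => E.mk g w := by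
  intro w w' h
  obtain ⟨k, -, h1, h2⟩ := Quotient.exact h
  have hk : k = 1 := by simpa using h1
  rw [hk, act_one] at h2
  exact (incl_injective h2).symm

lemma sectionMap_sectionV (v : V p q) (g : Gplus p q) :
    sectionMap (sectionV v) g = pr p q (act g⁻¹ v) :=
  Function.leftInverse_invFun (E.mk_injective g) _

lemma mat_curveG_inv (g : Gplus p q) (A : LieG p q) (t : ℝ) :
    mat (curveG g A t)⁻¹ = NormedSpace.exp (t • -A.1) * mat g⁻¹ := by
  rw [curveG, mul_inv_rev, mat_mul, smul_neg]
  rfl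

open scoped Matrix.Norms.Operator in
-- Along `t ↦ g exp(tA)` the function is `pr(exp(-tA) g⁻¹ v)`.
lemma differential_sectionV (v : V p q) (g : Gplus p q) :
    differential curveG (sectionMap (sectionV v)) g = -prAct p q (act g⁻¹ v) := by
  refine differential_eq _ _ _ _ fun A => ?_
  have h1 : HasDerivAt (fun t : ℝ => NormedSpace.exp (t • -A.1)) (-A.1) 0 := by
    have h := hasDerivAt_exp_smul_const (𝕂 := ℝ) (-A.1) 0
    rw [zero_smul, NormedSpace.exp_zero, one_mul] at h
    exact h
  let F : Matrix (Fin p ⊕ Fin q) (Fin p ⊕ Fin q) ℝ →ₗ[ℝ] Z q :=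
    { toFun := fun M => pr p q (M.mulVec (act g⁻¹ v))
      map_add' := fun M N => by rw [Matrix.add_mulVec, map_add]
      map_smul' := fun c M => by rw [Matrix.smul_mulVec, map_smul, RingHom.id_apply] }
  have h2 := (LinearMap.toContinuousLinearMap F).hasFDerivAt.comp_hasDerivAt (0 : ℝ) h1
  have h3 : F (-A.1) = (-prAct p q (act g⁻¹ v)) A := by
    change pr p q ((-A.1).mulVec _) = -pr p q (A.1.mulVec _)
    rw [Matrix.neg_mulVec, map_neg]
  rw [← h3]
  refine h2.congr_of_eventuallyEq (Filter.Eventually.of_forall fun t => ?_)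
  change sectionMap (sectionV v) (curveG g A t) =
    pr p q ((NormedSpace.exp (t • -A.1)).mulVec (act g⁻¹ v))
  rw [sectionMap_sectionV, act_apply, mat_curveG_inv, ← Matrix.mulVec_mulVec]
  rfl

/-- The nilpotent part of the exponent of `s_v^* U_MQ` at a point `g` with `g⁻¹ v = u`. -/
def kmExponent (u : V p q) : BiForms (LieG p q) q :=
  (2 * Real.sqrt Real.pi) • vectorForm (prAct p q (posPart p q u)) +
    (-(1 / 2) : ℝ) • ∑ α, vectorForm (prAct p q (ePos p q α)) ^ 2

lemma kmExponent_isNilpotent (u : V p q) : IsNilpotent (kmExponent u) := by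
  obtain ⟨N, hN⟩ := exists_pow_eq_zero Finset.univ (fun α => prAct p q (ePos p q α)) (-(1 / 2))
  exact ⟨N, hN _ _⟩

/-- The pullback of `∇̃𝐬` is `-pr(A u) + pr(A pr u)`, which is minus `pr(A ·)` at the positive part
of `u`. The sign turns `-2√π` into `2√π`. -/
lemma biMap_mqExponent_section (g : Gplus p q) (u : V p q) :
    biMap (LinearMap.prod LinearMap.id (-prAct p q u)) LinearMap.id
      (mqExponent p q (g, pr p q u)) = kmExponent u := by
  have h1 : LinearMap.id ∘ₗ covariantDerivative tautological (g, pr p q u) ∘ₗ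
      LinearMap.prod LinearMap.id (-prAct p q u) = -prAct p q (posPart p q u) := by
    refine LinearMap.ext fun A => ?_
    rw [LinearMap.comp_apply, LinearMap.comp_apply, LinearMap.id_apply,
      covariantDerivative_tautological, posPart_apply, map_sub, neg_sub]
    exact neg_add_eq_sub _ _
  have h2 : ∀ α, LinearMap.id ∘ₗ prActFst p q (ePos p q α) ∘ₗ
      LinearMap.prod LinearMap.id (-prAct p q u) = prAct p q (ePos p q α) := fun α => rfl
  rw [mqExponent, map_add, map_smul, map_smul, map_sum, biMap_vectorForm, h1, kmExponent,
    ← vectorFormHom_apply (-_), map_neg, smul_neg, neg_smul, neg_neg, vectorFormHom_apply]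
  simp only [map_pow, biMap_vectorForm, h2]

lemma pullbackSection_mathaiQuillen (b : Fin q → Z q) (v : V p q) (g : Gplus p q) :
    pullbackSection (sectionV v) (mathaiQuillen p q b) g =
      (mqConst q * Real.exp (-(2 * Real.pi *
        fiberInner p (pr p q (act g⁻¹ v)) (pr p q (act g⁻¹ v))))) •
      berezinForm p b (nilExp (kmExponent (act g⁻¹ v))) := by
  rw [pullbackSection, sectionMap_sectionV, differential_sectionV, mathaiQuillen_eq, map_smul,
    ← biMap_mqExponent_section g, ← map_nilExp _ (mqExponent_isNilpotent _), berezinForm_biMap,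
    LinearMap.det_id, one_smul]

lemma biMap_kmExponent (u : V p q) (k : Gplus p q) (hk : k ∈ K p q) :
    biMap (Ad k⁻¹) (rho k) (kmExponent (act k⁻¹ u)) = kmExponent u := by
  have h : ∀ x : V p q, rho k ∘ₗ prAct p q x ∘ₗ Ad k⁻¹ = prAct p q (act k x) := fun x =>
    LinearMap.ext fun A => rho_prAct_Ad k hk x A
  rw [kmExponent, map_add, map_smul, map_smul, map_sum, biMap_vectorForm, h, act_posPart k hk,
    act_act_inv, kmExponent]
  simp only [map_pow, biMap_vectorForm, h]
  congr 2
  exact sum_vectorForm_sq_act k hk (prAct p q)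

lemma kmExponent_mem_genAlg {M : Submodule ℝ (Module.Dual ℝ (LieG p q))} (u : V p q)
    (h : ∀ x μ, LinearMap.proj μ ∘ₗ prAct p q (posPart p q x) ∈ M) :
    kmExponent u ∈ genAlg q M := by
  refine add_mem (Subalgebra.smul_mem _ (vectorForm_mem_genAlg (h u)) _) (Subalgebra.smul_mem _
    (sum_mem fun α _ => pow_mem (vectorForm_mem_genAlg ?_) 2) _)
  rw [← posPart_ePos]
  exact h _

/-- The action of `g⁻¹` on `v` as a polynomial in the entries of `g`. -/
def actInv (v : V p q) (m : Fin p ⊕ Fin q → Fin p ⊕ Fin q → ℝ) : V p q :=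
  (gram p q * (Matrix.of m).transpose * gram p q).mulVec v

lemma actInv_entries (v : V p q) (g : Gplus p q) : actInv v (entries g) = act g⁻¹ v := by
  rw [act_apply, mat_inv]
  rfl

lemma contDiff_actInv (v : V p q) (i : Fin p ⊕ Fin q) :
    ContDiff ℝ ((⊤ : ℕ∞) : WithTop ℕ∞) fun m => actInv v m i := by
  simp only [actInv, Matrix.mulVec, dotProduct, Matrix.mul_apply, Matrix.transpose_apply,
    Matrix.of_apply]
  fun_prop

lemma kmExponent_actInv_mem_smoothMaps (v : V p q) :
    (fun m => kmExponent (actInv v m)) ∈ smoothMaps _ _ := by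
  simp only [kmExponent, posPart_eq_sum, ← vectorFormHom_apply, map_sum, map_smul]
  refine add_mem (Submodule.smul_mem _ (2 * Real.sqrt Real.pi) ?_) (const_mem_smoothMaps _)
  have : (fun m => ∑ α, actInv v m (Sum.inl α) • vectorFormHom _ q (prAct p q (ePos p q α))) =
      ∑ α, fun m => actInv v m (Sum.inl α) • vectorFormHom _ q (prAct p q (ePos p q α)) := by
    ext m; rw [Finset.sum_apply]
  rw [this]
  exact sum_mem fun α _ => smul_mem_smoothMaps (contDiff_actInv v _) _

lemma isFormOnD_pullbackSection (b : Fin q → Z q) (Γ : Subgroup (Gplus p q)) (v : V p q) :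
    IsFormOnD (stabilizerIn Γ v) q (pullbackSection (sectionV v) (mathaiQuillen p q b)) where
  degree g := by
    rw [pullbackSection_mathaiQuillen]
    refine Submodule.smul_mem _ _ (map_ι_pow_le ⊤ q (berezinForm_mem p b ?_))
    exact nilExp_mem (kmExponent_isNilpotent _) (kmExponent_mem_genAlg _ fun _ _ => trivial)
  smooth := by
    obtain ⟨N, hN⟩ := exists_pow_eq_zero Finset.univ (fun α => prAct p q (ePos p q α)) (-(1 / 2))
    refine isSmooth_of_mem_smoothMaps (f := fun m => (mqConst q * Real.exp (-(2 * Real.pi *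
        fiberInner p (pr p q (actInv v m)) (pr p q (actInv v m))))) •
        berezinForm p b (nilExp (kmExponent (actInv v m)))) ?_ fun g => ?_
    · refine fun_smul_mem_smoothMaps ?_ (map_mem_smoothMaps _ (nilExp_mem_smoothMaps
        (kmExponent_actInv_mem_smoothMaps v) (N := N) fun y => hN _ _))
      simp only [fiberInner_eq_sum]
      have h : ∀ μ, ContDiff ℝ ((⊤ : ℕ∞) : WithTop ℕ∞) fun m => pr p q (actInv v m) μ := fun μ =>
        contDiff_actInv v (Sum.inr μ)
      fun_prop
    · rw [pullbackSection_mathaiQuillen, actInv_entries]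
  horizontal g X hX := by
    rw [pullbackSection_mathaiQuillen, map_smul]
    refine (congrArg _ (interior_eq_zero (M := LinearMap.ker (Module.Dual.eval ℝ _ X))
      (fun a ha => ha) (berezinForm_mem p b (nilExp_mem (kmExponent_isNilpotent _)
        (kmExponent_mem_genAlg _ ?_))))).trans (smul_zero _)
    intro x μ
    rw [LinearMap.mem_ker, Module.Dual.eval_apply, LinearMap.comp_apply,
      prAct_posPart_of_mem_LieK _ hX, map_zero]
  invariant g k hk := by
    rw [pullbackSection_mathaiQuillen, pullbackSection_mathaiQuillen, map_smul, mul_inv_rev, act_mul,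
      ← rho_pr _ (inv_mem hk), fiberInner_rho _ (inv_mem hk), ← biMap_kmExponent (act g⁻¹ v) k hk,
      ← map_nilExp _ (kmExponent_isNilpotent _), berezinForm_biMap, det_rho k hk, one_smul]
  -- The group element enters only through `g⁻¹ v`.
  leftInvariant δ hδ g := by
    rw [pullbackSection_mathaiQuillen, pullbackSection_mathaiQuillen, mul_inv_rev, act_mul,
      show act δ⁻¹ v = v from (inv_mem hδ : δ⁻¹ ∈ stabilizerIn Γ v).2]

/-- Transfers the properties of `s_v^* U_MQ` to its constant multiple `φ_KM(v)`, which needs no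
verification of its own. -/
lemma IsFormOnD.const_smul {Δ : Subgroup (Gplus p q)} {n : ℕ} {α : Gplus p q → Forms (LieG p q)}
    (h : IsFormOnD Δ n α) (c : ℝ) : IsFormOnD Δ n (c • α) where
  degree g := Submodule.smul_mem _ _ (h.degree g)
  smooth ℓ := by
    obtain ⟨F, hF, e⟩ := h.smooth (c • ℓ)
    exact ⟨F, hF, fun x => by rw [e]; simp⟩
  horizontal g X hX := by rw [Pi.smul_apply, map_smul, h.horizontal g X hX, smul_zero]
  invariant g k hk := by rw [Pi.smul_apply, map_smul, h.invariant g k hk, Pi.smul_apply]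
  leftInvariant δ hδ g := by rw [Pi.smul_apply, h.leftInvariant δ hδ g, Pi.smul_apply]

end Pullback

section Howe

variable {p q : ℕ}

/-! ## The action of the creation operators -/

/-- Evaluation at `u` of a Schwartz function with values in a space `M`. -/
def evalTensor (M : Type) [AddCommGroup M] [Module ℝ M] (u : V p q) :
    M ⊗[ℝ] 𝓢(V p q, ℝ) →ₗ[ℝ] M :=
  (TensorProduct.rid ℝ M).toLinearMap ∘ₗ LinearMap.lTensor M
    ({ toFun := fun f => f u
       map_add' := fun _ _ => rfl
       map_smul' := fun _ _ => rfl } : 𝓢(V p q, ℝ) →ₗ[ℝ] ℝ)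

section evalTensor

variable {M N : Type} [AddCommGroup M] [Module ℝ M] [AddCommGroup N] [Module ℝ N]

lemma evalTensor_tmul (u : V p q) (m : M) (f : 𝓢(V p q, ℝ)) :
    evalTensor M u (m ⊗ₜ f) = f u • m := rfl

lemma evalTensor_map (u : V p q) (L : M →ₗ[ℝ] N) (D : 𝓢(V p q, ℝ) →ₗ[ℝ] 𝓢(V p q, ℝ))
    (Y : M ⊗[ℝ] 𝓢(V p q, ℝ)) :
    evalTensor N u (TensorProduct.map L D Y) = L (evalTensor M u (LinearMap.lTensor M D Y)) := by
  induction Y using TensorProduct.induction_on with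
  | zero => simp
  | tmul m f => rw [TensorProduct.map_tmul, LinearMap.lTensor_tmul, evalTensor_tmul,
      evalTensor_tmul, map_smul]
  | add x y hx hy => simp only [map_add, hx, hy]

lemma creation_apply (α : Fin p) (f : 𝓢(V p q, ℝ)) (u : V p q) :
    creation α f u = u (Sum.inl α) * f u - 1 / (2 * Real.pi) * fderiv ℝ f u (ePos p q α) := by
  have h : Function.HasTemperateGrowth (fun v : V p q => v (Sum.inl α)) :=
    (ContinuousLinearMap.proj (R := ℝ) (φ := fun _ : Fin p ⊕ Fin q => ℝ)
      (Sum.inl α)).hasTemperateGrowth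
  rw [← SchwartzMap.lineDerivOp_apply_eq_fderiv]
  simp only [creation, LinearMap.sub_apply, LinearMap.smul_apply]
  simp [h, ePos]

/-- The definition of the creation operator solved for the derivative: `∂_α = 2π (x_α - D_α)`. -/
lemma hasDerivAt_evalTensor (α : Fin p) (u : V p q) (Y : M ⊗[ℝ] 𝓢(V p q, ℝ))
    (ℓ : Module.Dual ℝ M) :
    HasDerivAt (fun t : ℝ => ℓ (evalTensor M (u + t • ePos p q α) Y))
      (2 * Real.pi * (u (Sum.inl α) * ℓ (evalTensor M u Y) -
        ℓ (evalTensor M u (LinearMap.lTensor M (creation α) Y)))) 0 := by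
  induction Y using TensorProduct.induction_on with
  | zero => simpa using hasDerivAt_const (0 : ℝ) (0 : ℝ)
  | tmul m f =>
    simp only [LinearMap.lTensor_tmul, evalTensor_tmul, map_smul, creation_apply, smul_eq_mul]
    have h1 : HasDerivAt (fun t : ℝ => u + t • ePos p q α) (ePos p q α) 0 := by
      simpa using ((hasDerivAt_id (0 : ℝ)).smul_const (ePos p q α)).const_add u
    have h2 : HasFDerivAt f (fderiv ℝ f u) (u + (0 : ℝ) • ePos p q α) := by
      rw [zero_smul, add_zero]; exact f.differentiableAt.hasFDerivAt
    refine ((h2.comp_hasDerivAt (0 : ℝ) h1).mul_const (ℓ m)).congr_deriv ?_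
    have := Real.pi_ne_zero
    field_simp
    ring
  | add x y hx hy =>
    simp only [map_add]
    refine (hx.add hy).congr_deriv ?_
    ring

/-- The effect of `D_α` at a point is determined by the derivative of the values of `Y`; no explicit
expression of `Y` as a tensor is needed, and no topology on `M`. -/
lemma evalTensor_creation (α : Fin p) (u : V p q) (Y : M ⊗[ℝ] 𝓢(V p q, ℝ)) (d : M)
    (hd : ∀ ℓ : Module.Dual ℝ M,
      HasDerivAt (fun t : ℝ => ℓ (evalTensor M (u + t • ePos p q α) Y)) (ℓ d) 0) :
    evalTensor M u (LinearMap.lTensor M (creation α) Y) =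
      u (Sum.inl α) • evalTensor M u Y - (1 / (2 * Real.pi)) • d := by
  rw [← sub_eq_zero, ← Module.forall_dual_apply_eq_zero_iff ℝ]
  intro ℓ
  have h := (hd ℓ).unique (hasDerivAt_evalTensor α u Y ℓ)
  have := Real.pi_ne_zero
  simp only [map_sub, map_smul, smul_eq_mul, h]
  field_simp
  ring

end evalTensor

/-! ## The generating function of the Howe operator -/

/-- The linear map `A ↦ ω_{αμ}(A) e_μ`. -/
def cell (α : Fin p) (μ : Fin q) : LieG p q →ₗ[ℝ] Z q :=
  LinearMap.single ℝ (fun _ : Fin q => ℝ) μ ∘ₗ omega α μ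

lemma vectorForm_cell (α : Fin p) (μ : Fin q) :
    vectorForm (cell α μ) = gen (omega α μ) (Pi.single μ 1 : Z q) := by
  rw [vectorForm_eq_sum_gen, Finset.sum_eq_single_of_mem μ (Finset.mem_univ _)]
  · congr 1
    ext A
    simp [cell]
  · intro ν _ hν
    have : LinearMap.proj ν ∘ₗ cell α μ = (0 : Module.Dual ℝ (LieG p q)) := by
      ext A
      simp [cell, hν]
    rw [this, ← genHom_apply, map_zero, LinearMap.zero_apply]

/-- The sum of the maps `A ↦ ω_{αμ}(A) e_μ` over a list of indices `μ`. -/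
def row (l : List (Fin q)) (α : Fin p) : LieG p q →ₗ[ℝ] Z q := (l.map (cell α)).sum

lemma row_cons (m : Fin q) (l : List (Fin q)) (α : Fin p) :
    row (m :: l) α = cell α m + row l α := by
  simp [row]

lemma row_finRange (α : Fin p) : row (List.finRange q) α = prAct p q (ePos p q α) := by
  have h : row (List.finRange q) α = ∑ μ, cell α μ := by
    rw [row, ← List.ofFn_eq_map, List.sum_ofFn]
  rw [h]
  refine LinearMap.ext fun A => funext fun ν => ?_
  rw [prAct_ePos]
  simp [cell, omega_apply, Finset.sum_apply, Pi.single_apply]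

/-- The exponent of `s_v^* U_MQ` restricted to the indices in a list. -/
def partialExponent (l : List (Fin q)) (u : V p q) : BiForms (LieG p q) q :=
  (2 * Real.sqrt Real.pi) • vectorForm (∑ α, u (Sum.inl α) • row l α) +
    (-(1 / 2) : ℝ) • ∑ α, vectorForm (row l α) ^ 2

lemma partialExponent_finRange (u : V p q) : partialExponent (List.finRange q) u = kmExponent u := by
  simp only [partialExponent, kmExponent, row_finRange, posPart_eq_sum, map_sum, map_smul]

lemma partialExponent_isNilpotent (l : List (Fin q)) (u : V p q) :
    IsNilpotent (partialExponent l u) := by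
  obtain ⟨N, hN⟩ := exists_pow_eq_zero Finset.univ (row (p := p) l) (-(1 / 2))
  exact ⟨N, hN _ _⟩

lemma vectorForm_mem_genAlg_top {T : Type} [AddCommGroup T] [Module ℝ T] (L : T →ₗ[ℝ] Z q) :
    vectorForm L ∈ genAlg q (⊤ : Submodule ℝ (Module.Dual ℝ T)) :=
  vectorForm_mem_genAlg fun _ => trivial

lemma partialExponent_mem_genAlg (l : List (Fin q)) (u : V p q) :
    partialExponent l u ∈ genAlg q (⊤ : Submodule ℝ (Module.Dual ℝ (LieG p q))) :=
  add_mem (Subalgebra.smul_mem _ (vectorForm_mem_genAlg_top _) _) (Subalgebra.smul_mem _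
    (sum_mem fun _ _ => pow_mem (vectorForm_mem_genAlg_top _) 2) _)

/-- The increment of the exponent when an index is added to the list. -/
def increment (m : Fin q) (l : List (Fin q)) (u : V p q) : BiForms (LieG p q) q :=
  ∑ α, vectorForm (cell α m) *
    ((2 * Real.sqrt Real.pi * u (Sum.inl α)) • 1 - vectorForm (row l α))

lemma vectorForm_cell_mul (α β : Fin p) (m : Fin q) :
    vectorForm (cell α m) * vectorForm (cell β m) = 0 := by
  rw [vectorForm_cell, vectorForm_cell, gen_mul_gen_self_right]

lemma increment_mem_genAlg (m : Fin q) (l : List (Fin q)) (u : V p q) :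
    increment m l u ∈ genAlg q (⊤ : Submodule ℝ (Module.Dual ℝ (LieG p q))) :=
  sum_mem fun _ _ => mul_mem (vectorForm_mem_genAlg_top _)
    (sub_mem (Subalgebra.smul_mem _ (one_mem _) _) (vectorForm_mem_genAlg_top _))

/-- Every term contains the vector `e_m`, whose square in `⋀ z₀` is zero. -/
lemma increment_mul_self (m : Fin q) (l : List (Fin q)) (u : V p q) :
    increment m l u * increment m l u = 0 := by
  rw [increment, Finset.sum_mul_sum]
  refine Finset.sum_eq_zero fun α _ => Finset.sum_eq_zero fun β _ => ?_
  have hc := commute_of_mem_genAlg (M := ⊤)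
    (sub_mem (Subalgebra.smul_mem _ (one_mem _) (2 * Real.sqrt Real.pi * u (Sum.inl α)))
      (vectorForm_mem_genAlg_top (row l α))) (vectorForm_mem_genAlg_top (cell β m))
  rw [mul_assoc, ← mul_assoc _ (vectorForm (cell β m)), hc.eq, ← mul_assoc, ← mul_assoc,
    vectorForm_cell_mul, zero_mul, zero_mul]

/-- Products of two cells with the same `m` vanish, so the square of the longer row gains only a
cross term, halved and negated by the factor `-½`. -/
lemma partialExponent_cons (m : Fin q) (l : List (Fin q)) (u : V p q) :
    partialExponent (m :: l) u = partialExponent l u + increment m l u := by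
  have h : ∀ α : Fin p, vectorForm (row (m :: l) α) ^ 2 = vectorForm (row l α) ^ 2 +
      (2 : ℝ) • (vectorForm (cell α m) * vectorForm (row l α)) := by
    intro α
    have hc := vectorForm_commute (row l α) (cell α m)
    rw [row_cons, ← vectorFormHom_apply, map_add, vectorFormHom_apply, vectorFormHom_apply, pow_two,
      add_mul, mul_add, mul_add, vectorForm_cell_mul, hc.eq, two_smul, pow_two]
    abel
  simp only [partialExponent, increment, h]
  simp only [row_cons, ← vectorFormHom_apply, map_sum, map_smul,
    map_add, Finset.sum_add_distrib, smul_add, mul_sub, Finset.sum_sub_distrib, mul_smul_comm,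
    mul_one, Finset.smul_sum, smul_smul]
  norm_num
  abel

lemma nilExp_partialExponent_cons (m : Fin q) (l : List (Fin q)) (u : V p q) :
    nilExp (partialExponent (m :: l) u) =
      nilExp (partialExponent l u) + increment m l u * nilExp (partialExponent l u) := by
  have h0 := increment_mul_self m l u
  have hc := commute_of_mem_genAlg (increment_mem_genAlg m l u)
    (partialExponent_mem_genAlg l u)
  rw [partialExponent_cons, add_comm, nilExp_add hc ⟨2, by rw [pow_two, h0]⟩
    (partialExponent_isNilpotent l u), nilExp_of_mul_self_eq_zero h0, add_mul, one_mul]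

lemma siegelMajorant_add_smul (u : V p q) (α : Fin p) (t : ℝ) :
    siegelMajorant (u + t • ePos p q α) = siegelMajorant u + 2 * t * u (Sum.inl α) + t ^ 2 := by
  have h : ∀ i, (u + t • ePos p q α) i ^ 2 =
      u i ^ 2 + (ePos p q α i * (2 * t * u (Sum.inl α) + t ^ 2)) := by
    intro i
    by_cases hi : i = Sum.inl α
    · subst hi; simp [ePos]; ring
    · simp [ePos, hi]
  simp only [siegelMajorant, h, Finset.sum_add_distrib, ← Finset.sum_mul]
  simp [ePos]
  ring

lemma partialExponent_add_smul (l : List (Fin q)) (u : V p q) (α : Fin p) (t : ℝ) :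
    partialExponent l (u + t • ePos p q α) =
      partialExponent l u + t • ((2 * Real.sqrt Real.pi) • vectorForm (row l α)) := by
  have h : ∑ β, (u + t • ePos p q α) (Sum.inl β) • row l β =
      ∑ β, u (Sum.inl β) • row l β + t • row l α := by
    simp [ePos, add_smul, Finset.sum_add_distrib, Pi.single_apply]
  simp only [partialExponent, h, ← vectorFormHom_apply, map_add, map_smul, smul_add]
  rw [smul_comm t]
  abel

/-- The Gaussian times the exponential of `partialExponent`. -/
def partialGaussian (l : List (Fin q)) (u : V p q) : BiForms (LieG p q) q :=
  gaussian p q u • nilExp (partialExponent l u)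

/-- The exponent is affine in `u`: differentiating the Gaussian gives `-2π u_α`, and differentiating
the nilpotent exponential gives `2√π` times the row of `α`. -/
lemma hasDerivAt_partialGaussian (l : List (Fin q)) (u : V p q) (α : Fin p)
    (ℓ : Module.Dual ℝ (BiForms (LieG p q) q)) :
    HasDerivAt (fun t : ℝ => ℓ (partialGaussian l (u + t • ePos p q α)))
      (ℓ ((-(2 * Real.pi * u (Sum.inl α))) • partialGaussian l u +
        (2 * Real.sqrt Real.pi) • (vectorForm (row l α) * partialGaussian l u))) 0 := by
  set z : BiForms (LieG p q) q := (2 * Real.sqrt Real.pi) • vectorForm (row l α) with hz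
  have hzn : IsNilpotent z := (vectorForm_isNilpotent _).smul _
  have hzm := Subalgebra.smul_mem _ (vectorForm_mem_genAlg_top (row l α)) (2 * Real.sqrt Real.pi)
  have h1 : ∀ t : ℝ, ℓ (partialGaussian l (u + t • ePos p q α)) =
      Real.exp (-Real.pi * (siegelMajorant u + 2 * t * u (Sum.inl α) + t ^ 2)) *
        ℓ (nilExp (partialExponent l u) * nilExp (t • z)) := by
    intro t
    rw [partialGaussian, partialExponent_add_smul, nilExp_add _ (partialExponent_isNilpotent l u)
      (hzn.smul t), map_smul, ← siegelMajorant_add_smul]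
    · rfl
    · exact commute_of_mem_genAlg (partialExponent_mem_genAlg l u) (Subalgebra.smul_mem _ hzm t)
  have h2 : HasDerivAt (fun t : ℝ => siegelMajorant u + 2 * t * u (Sum.inl α) + t ^ 2)
      (2 * u (Sum.inl α)) 0 := by
    refine (((((hasDerivAt_id (0 : ℝ)).const_mul 2).mul_const (u (Sum.inl α))).const_add
      (siegelMajorant u)).add (hasDerivAt_pow 2 (0 : ℝ))).congr_deriv ?_
    simp
  have h3 := ((h2.const_mul (-Real.pi)).exp).mul
    (hasDerivAt_mul_nilExp_smul (nilExp (partialExponent l u)) hzn ℓ)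
  simp_rw [h1]
  refine h3.congr_deriv ?_
  have h4 : vectorForm (row l α) * nilExp (partialExponent l u) =
      nilExp (partialExponent l u) * vectorForm (row l α) :=
    commute_of_mem_genAlg (vectorForm_mem_genAlg_top _)
      (nilExp_mem (partialExponent_isNilpotent l u) (partialExponent_mem_genAlg l u))
  have h5 : nilExp (0 : BiForms (LieG p q) q) = 1 := by
    rw [nilExp_of_mul_self_eq_zero (mul_zero _), add_zero]
  have h6 : gaussian p q u = Real.exp (-Real.pi * siegelMajorant u) := rfl
  simp only [partialGaussian, zero_smul, h5, mul_one, mul_zero, zero_mul, add_zero,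
    mul_smul_comm, h4, map_add, map_smul, smul_eq_mul, h6, hz, ne_eq, OfNat.ofNat_ne_zero,
    not_false_eq_true, zero_pow]
  ring

/-- The operator `∑_α (ω_{αm} ⊗ e_m) ⊗ (x_α - (1/2π) ∂/∂x_α)`. -/
def biHowe (m : Fin q) : Module.End ℝ (BiForms (LieG p q) q ⊗[ℝ] 𝓢(V p q, ℝ)) :=
  ∑ α : Fin p, TensorProduct.map (LinearMap.mulLeft ℝ (vectorForm (cell α m))) (creation α)

/-- The product of the operators `1 + √π biHowe m` over a list, applied to the Gaussian. -/
def expansion : List (Fin q) → BiForms (LieG p q) q ⊗[ℝ] 𝓢(V p q, ℝ)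
  | [] => 1 ⊗ₜ gaussian p q
  | m :: l => expansion l + Real.sqrt Real.pi • biHowe m (expansion l)

/-- On the partial Gaussian, `√π D_α` acts as `√π (u_α - (1/2π)(-2π u_α + 2√π L_α)) = 2√π u_α -
L_α`, with `L_α` the row over `l`. This is exactly the coefficient of the cell in `increment`. -/
lemma evalTensor_expansion (l : List (Fin q)) (u : V p q) :
    evalTensor _ u (expansion l) = partialGaussian l u := by
  induction l generalizing u with
  | nil =>
    have h : partialExponent ([] : List (Fin q)) u = 0 := by
      simp [partialExponent, row, ← vectorFormHom_apply]
    rw [expansion, evalTensor_tmul, partialGaussian, h, nilExp_of_mul_self_eq_zero (mul_zero _),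
      add_zero]
  | cons m l ih =>
    have h : ∀ α, evalTensor _ u (LinearMap.lTensor _ (creation α) (expansion l)) =
        u (Sum.inl α) • partialGaussian l u - (1 / (2 * Real.pi)) •
          ((-(2 * Real.pi * u (Sum.inl α))) • partialGaussian l u +
        (2 * Real.sqrt Real.pi) • (vectorForm (row l α) * partialGaussian l u)) := by
      intro α
      rw [evalTensor_creation α u (expansion l) _ fun ℓ => ?_, ih]
      simp only [ih]
      exact hasDerivAt_partialGaussian l u α ℓ
    have hs : Real.sqrt Real.pi * Real.sqrt Real.pi = Real.pi := Real.mul_self_sqrt Real.pi_pos.le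
    have hp := Real.pi_ne_zero
    rw [expansion, map_add, ih, map_smul, biHowe, LinearMap.sum_apply, map_sum]
    simp only [evalTensor_map, LinearMap.mulLeft_apply, h]
    rw [partialGaussian, partialGaussian, nilExp_partialExponent_cons, smul_add, increment,
      Finset.sum_mul, Finset.smul_sum, Finset.smul_sum]
    congr 1
    refine Finset.sum_congr rfl fun α _ => ?_
    simp only [mul_assoc, sub_mul, smul_mul_assoc, one_mul, mul_smul_comm, mul_sub, mul_add,
      smul_sub, smul_add, smul_smul]
    match_scalars
    · field_simp
      ring
    · field_simp
      rw [pow_two, hs]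

end Howe

section TopDegree

variable {p q : ℕ}

/-! ## The top degree part -/

/-- The operator `∑_α A_{αm} ⊗ (x_α - (1/2π) ∂/∂x_α)`. -/
def howeFactor (m : Fin q) : Module.End ℝ (Forms (LieG p q) ⊗[ℝ] 𝓢(V p q, ℝ)) :=
  ∑ α : Fin p, TensorProduct.map (LinearMap.mulLeft ℝ (ExteriorAlgebra.ι ℝ (omega α m)))
    (creation α)

/-- The span of the `ω ⊗ f` with `ω` of degree `n`. -/
def homogeneousPart (p q n : ℕ) : Submodule ℝ (Forms (LieG p q) ⊗[ℝ] 𝓢(V p q, ℝ)) :=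
  Submodule.span ℝ {Y | ∃ ω ∈ ⋀[ℝ]^n (Module.Dual ℝ (LieG p q)), ∃ f, Y = ω ⊗ₜ f}

/-- The span of the `(ω ⊗ s) ⊗ f` with `s` of degree less than `n`. -/
def lowerPart (p q n : ℕ) : Submodule ℝ (BiForms (LieG p q) q ⊗[ℝ] 𝓢(V p q, ℝ)) :=
  Submodule.span ℝ {x | ∃ k, ∃ ω ∈ ⋀[ℝ]^k (Module.Dual ℝ (LieG p q)), ∃ j < n,
    ∃ s ∈ ⋀[ℝ]^j (Z q), ∃ f, x = biTmul ω s ⊗ₜ f}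

/-- The map `ω ⊗ f ↦ (ω ⊗ s) ⊗ f`. -/
def insertRight (s : ExteriorAlgebra ℝ (Z q)) :
    Forms (LieG p q) ⊗[ℝ] 𝓢(V p q, ℝ) →ₗ[ℝ] BiForms (LieG p q) q ⊗[ℝ] 𝓢(V p q, ℝ) :=
  LinearMap.rTensor _ ((biTmulHom (LieG p q) q).flip s)

lemma insertRight_tmul (s : ExteriorAlgebra ℝ (Z q)) (ω : Forms (LieG p q)) (f : 𝓢(V p q, ℝ)) :
    insertRight s (ω ⊗ₜ f) = biTmul ω s ⊗ₜ f := rfl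

lemma ι_mul_mem_exteriorPower {M : Type} [AddCommGroup M] [Module ℝ M] (m : M) {n : ℕ}
    {x : ExteriorAlgebra ℝ M} (hx : x ∈ ⋀[ℝ]^n M) : ExteriorAlgebra.ι ℝ m * x ∈ ⋀[ℝ]^(n + 1) M := by
  rw [ExteriorAlgebra.exteriorPower, pow_succ']
  exact Submodule.mul_mem_mul ⟨m, rfl⟩ hx

lemma lowerPart_mono {m n : ℕ} (h : m ≤ n) : lowerPart p q m ≤ lowerPart p q n :=
  Submodule.span_mono fun _ ⟨k, ω, hω, j, hj, r⟩ => ⟨k, ω, hω, j, hj.trans_le h, r⟩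

lemma howeFactor_mem (m : Fin q) {n : ℕ} {Y : Forms (LieG p q) ⊗[ℝ] 𝓢(V p q, ℝ)}
    (hY : Y ∈ homogeneousPart p q n) : howeFactor m Y ∈ homogeneousPart p q (n + 1) := by
  induction hY using Submodule.span_induction with
  | mem Y hY =>
    obtain ⟨ω, hω, f, rfl⟩ := hY
    rw [howeFactor, LinearMap.sum_apply]
    exact sum_mem fun α _ => Submodule.subset_span ⟨_, ι_mul_mem_exteriorPower _ hω, _, rfl⟩
  | zero => rw [map_zero]; exact zero_mem _
  | add x y _ _ hx hy => rw [map_add]; exact add_mem hx hy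
  | smul c x _ hx => rw [map_smul]; exact Submodule.smul_mem _ _ hx

lemma biHowe_biTmul_tmul (m : Fin q) {k : ℕ} {ω : Forms (LieG p q)}
    (hω : ω ∈ ⋀[ℝ]^k (Module.Dual ℝ (LieG p q))) (s : ExteriorAlgebra ℝ (Z q))
    (f : 𝓢(V p q, ℝ)) :
    biHowe m (biTmul ω s ⊗ₜ[ℝ] f) = (-1 : ℝ) ^ k • ∑ α : Fin p,
      biTmul (ExteriorAlgebra.ι ℝ (omega α m) * ω) (eVec m * s) ⊗ₜ[ℝ] creation α f := by
  rw [biHowe, LinearMap.sum_apply, Finset.smul_sum]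
  refine Finset.sum_congr rfl fun α _ => ?_
  rw [TensorProduct.map_tmul, LinearMap.mulLeft_apply, vectorForm_cell, gen_mul_biTmul _ _ hω,
    TensorProduct.smul_tmul']
  rfl

lemma biHowe_mem (m : Fin q) {n : ℕ} {x : BiForms (LieG p q) q ⊗[ℝ] 𝓢(V p q, ℝ)}
    (hx : x ∈ lowerPart p q n) : biHowe m x ∈ lowerPart p q (n + 1) := by
  induction hx using Submodule.span_induction with
  | mem x hx =>
    obtain ⟨k, ω, hω, j, hj, s, hs, f, rfl⟩ := hx
    rw [biHowe_biTmul_tmul m hω]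
    exact Submodule.smul_mem _ _ (sum_mem fun α _ => Submodule.subset_span
      ⟨k + 1, _, ι_mul_mem_exteriorPower _ hω, j + 1, by omega, _, ι_mul_mem_exteriorPower _ hs, _,
        rfl⟩)
  | zero => rw [map_zero]; exact zero_mem _
  | add x y _ _ hx hy => rw [map_add]; exact add_mem hx hy
  | smul c x _ hx => rw [map_smul]; exact Submodule.smul_mem _ _ hx

/-- Moving `e_m` past a form of degree `n` costs the sign. -/
lemma biHowe_insertRight (m : Fin q) {n : ℕ} {Y : Forms (LieG p q) ⊗[ℝ] 𝓢(V p q, ℝ)}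
    (hY : Y ∈ homogeneousPart p q n) (s : ExteriorAlgebra ℝ (Z q)) :
    biHowe m (insertRight s Y) = (-1 : ℝ) ^ n • insertRight (eVec m * s) (howeFactor m Y) := by
  induction hY using Submodule.span_induction with
  | mem Y hY =>
    obtain ⟨ω, hω, f, rfl⟩ := hY
    rw [insertRight_tmul, biHowe_biTmul_tmul m hω, howeFactor, LinearMap.sum_apply, map_sum]
    rfl
  | zero => simp
  | add x y _ _ hx hy => simp only [map_add, hx, hy, smul_add]
  | smul c x _ hx => simp only [map_smul, hx, smul_comm c]

lemma insertRight_mem {n j : ℕ} {Y : Forms (LieG p q) ⊗[ℝ] 𝓢(V p q, ℝ)}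
    (hY : Y ∈ homogeneousPart p q n) {s : ExteriorAlgebra ℝ (Z q)} (hs : s ∈ ⋀[ℝ]^j (Z q)) :
    insertRight s Y ∈ lowerPart p q (j + 1) := by
  induction hY using Submodule.span_induction with
  | mem Y hY =>
    obtain ⟨ω, hω, f, rfl⟩ := hY
    exact Submodule.subset_span ⟨n, ω, hω, j, j.lt_succ_self, s, hs, f, rfl⟩
  | zero => rw [map_zero]; exact zero_mem _
  | add x y _ _ hx hy => rw [map_add]; exact add_mem hx hy
  | smul c x _ hx => rw [map_smul]; exact Submodule.smul_mem _ _ hx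

lemma prod_howeFactor_mem (l : List (Fin q)) :
    (l.map howeFactor).prod (1 ⊗ₜ[ℝ] gaussian p q) ∈ homogeneousPart p q l.length := by
  induction l with
  | nil => exact Submodule.subset_span ⟨1, one_mem_exteriorPower_zero, _, rfl⟩
  | cons m l ih =>
    rw [List.map_cons, List.prod_cons, Module.End.mul_apply]
    exact howeFactor_mem m ih

lemma prod_eVec_mem (l : List (Fin q)) : (l.map eVec).prod ∈ ⋀[ℝ]^l.length (Z q) := by
  induction l with
  | nil => exact one_mem_exteriorPower_zero
  | cons m l ih =>
    rw [List.map_cons, List.prod_cons]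
    exact ι_mul_mem_exteriorPower _ ih

/-- The coefficient `√π ^ n (-1) ^ (n (n - 1) / 2)`. -/
def topCoeff (n : ℕ) : ℝ := ∏ i ∈ Finset.range n, (Real.sqrt Real.pi * (-1) ^ i)

lemma add_smul_biHowe_sub (m : Fin q) {n : ℕ} {Y : Forms (LieG p q) ⊗[ℝ] 𝓢(V p q, ℝ)}
    (hY : Y ∈ homogeneousPart p q n) (s : ExteriorAlgebra ℝ (Z q)) (a c : ℝ)
    (X : BiForms (LieG p q) q ⊗[ℝ] 𝓢(V p q, ℝ)) :
    X + a • biHowe m X - (a * (c * (-1) ^ n)) • insertRight (eVec m * s) (howeFactor m Y) =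
      X + a • biHowe m (X - c • insertRight s Y) := by
  rw [map_sub, map_smul, biHowe_insertRight m hY, smul_sub, smul_smul, smul_smul, add_sub_assoc,
    mul_assoc]

/-- Choosing the summand `1` in any factor loses a degree in `⋀ z₀`, so modulo lower degree only the
product of all the other summands remains. The signs accumulated in it form `topCoeff`. -/
lemma expansion_sub_mem_lowerPart (l : List (Fin q)) :
    expansion l - topCoeff l.length • insertRight (l.map eVec).prod
      ((l.map howeFactor).prod (1 ⊗ₜ[ℝ] gaussian p q)) ∈ lowerPart p q l.length := by
  induction l with
  | nil =>
    have : expansion ([] : List (Fin q)) = insertRight 1 (1 ⊗ₜ[ℝ] gaussian p q) := rfl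
    simp [this, topCoeff]
  | cons m l ih =>
    have hY := prod_howeFactor_mem (p := p) l
    have h1 : expansion l ∈ lowerPart p q (l.length + 1) := by
      rw [← sub_add_cancel (expansion l)]
      exact add_mem (lowerPart_mono (Nat.le_succ _) ih)
        (Submodule.smul_mem _ _ (insertRight_mem hY (prod_eVec_mem l)))
    have h2 : topCoeff (l.length + 1) = Real.sqrt Real.pi * (topCoeff l.length *
        (-1) ^ l.length) := by
      rw [topCoeff, Finset.prod_range_succ, ← topCoeff]; ring
    rw [List.map_cons, List.prod_cons, List.map_cons, List.prod_cons, Module.End.mul_apply,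
      List.length_cons, h2, expansion, add_smul_biHowe_sub m hY]
    exact add_mem h1 (Submodule.smul_mem _ _ (biHowe_mem m ih))

lemma evalTensor_insertRight (u : V p q) (s : ExteriorAlgebra ℝ (Z q))
    (Y : Forms (LieG p q) ⊗[ℝ] 𝓢(V p q, ℝ)) :
    evalTensor _ u (insertRight s Y) = biTmul (evalAt u Y) s :=
  evalTensor_map u _ LinearMap.id Y |>.trans (by rw [LinearMap.lTensor_id]; rfl)

lemma berezinForm_evalTensor_eq_zero (b : Fin q → Z q) (u : V p q)
    {x : BiForms (LieG p q) q ⊗[ℝ] 𝓢(V p q, ℝ)} (hx : x ∈ lowerPart p q q) :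
    berezinForm p b (evalTensor _ u x) = 0 := by
  induction hx using Submodule.span_induction with
  | mem x hx =>
    obtain ⟨k, ω, hω, j, hj, s, hs, f, rfl⟩ := hx
    rw [evalTensor_tmul, map_smul, berezinForm_biTmul, berezin_eq_zero p b hj.ne hs, zero_smul,
      smul_zero]
  | zero => simp
  | add x y _ _ hx hy => simp only [map_add, hx, hy, add_zero]
  | smul c x _ hx => simp only [map_smul, hx, smul_zero]

lemma berezin_prod_eVec (b : Fin q → Z q) :
    berezin p b ((List.finRange q).map eVec).prod = (Matrix.of b).det := by
  have h : ((List.finRange q).map eVec).prod =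
      ExteriorAlgebra.ιMulti ℝ q fun μ => (Pi.single μ 1 : Z q) := by
    rw [← List.ofFn_eq_map, ExteriorAlgebra.ιMulti_apply]
    rfl
  rw [h, berezin_ιMulti, ← Matrix.det_transpose]
  congr 1
  ext i j
  simp [fiberInner_eq_sum, Pi.single_apply]

lemma howe_eq (p q : ℕ) :
    howe p q = (1 / 2 ^ q : ℝ) • ((List.finRange q).map (howeFactor (p := p))).prod := by
  rw [howe, List.ofFn_eq_map]
  rfl

/-- The Berezin integral of the expansion over all indices: lower degrees vanish and `e_1 ∧ ⋯ ∧ e_q`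
integrates to the determinant of `b`. The factor `2 ^ q` undoes the normalization of the Howe
operator. -/
lemma gaussian_smul_berezinForm_nilExp (b : Fin q → Z q) (u : V p q) :
    gaussian p q u • berezinForm p b (nilExp (kmExponent u)) =
      (topCoeff q * (Matrix.of b).det * 2 ^ q) • kudlaMillsonBase u := by
  have h1 := berezinForm_evalTensor_eq_zero b u (by
    simpa only [List.length_finRange] using expansion_sub_mem_lowerPart (p := p) (List.finRange q))
  rw [map_sub, map_sub, sub_eq_zero, evalTensor_expansion, partialGaussian, map_smul,
    partialExponent_finRange] at h1
  rw [h1, map_smul, map_smul, evalTensor_insertRight, berezinForm_biTmul, berezin_prod_eVec,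
    kudlaMillsonBase, howe_eq, LinearMap.smul_apply, map_smul, smul_smul, smul_smul]
  congr 1
  field_simp

/-! ## Comparison of the two forms -/

lemma det_mul_self (b : Fin q → Z q)
    (hb : ∀ i j, fiberInner p (b i) (b j) = if i = j then 1 else 0) :
    (Matrix.of b).det * (Matrix.of b).det = 1 := by
  have h : Matrix.of b * (Matrix.of b).transpose = 1 := by
    ext i j
    rw [Matrix.one_apply, ← hb, fiberInner_eq_sum, Matrix.mul_apply]
    rfl
  have := congrArg Matrix.det h
  rwa [Matrix.det_mul, Matrix.det_transpose, Matrix.det_one] at this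

/-! ### Normalizing constants and conclusion -/

lemma rpow_neg_div_two {x : ℝ} (hx : 0 ≤ x) (n : ℕ) : x ^ (-(n : ℝ) / 2) = (Real.sqrt x)⁻¹ ^ n := by
  rw [Real.sqrt_eq_rpow, ← Real.rpow_neg hx, ← Real.rpow_natCast, ← Real.rpow_mul hx]
  congr 1
  ring

lemma const_identity (n : ℕ) :
    (-1 : ℝ) ^ n * (2 : ℝ) ^ (-(n : ℝ) / 2) * mqConst n * topCoeff n * 2 ^ n = 1 := by
  rw [mqConst, rpow_neg_div_two (by norm_num), rpow_neg_div_two (by positivity),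
    Real.sqrt_mul (by norm_num)]
  induction n with
  | zero => simp [topCoeff]
  | succ n ih =>
    have e : (n + 1) * (n + 1 + 1) / 2 = n * (n + 1) / 2 + (n + 1) := by
      rw [show (n + 1) * (n + 1 + 1) = n * (n + 1) + (n + 1) * 2 by ring,
        Nat.add_mul_div_right _ _ two_pos]
    have e2 : topCoeff (n + 1) = topCoeff n * (Real.sqrt Real.pi * (-1) ^ n) := by
      rw [topCoeff, Finset.prod_range_succ, ← topCoeff]
    have h2 : Real.sqrt 2 * Real.sqrt 2 = 2 := Real.mul_self_sqrt (by norm_num)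
    have h20 : Real.sqrt 2 ≠ 0 := by positivity
    have hp0 : Real.sqrt Real.pi ≠ 0 := (Real.sqrt_pos.2 Real.pi_pos).ne'
    have hs : ((-1 : ℝ) ^ n) * (-1) ^ n = 1 := by rw [← mul_pow]; norm_num
    have h3 : (Real.sqrt 2)⁻¹ * (Real.sqrt 2 * Real.sqrt Real.pi)⁻¹ * Real.sqrt Real.pi * 2 = 1 := by
      field_simp
      rw [pow_two, h2]
    rw [e, e2]
    -- From `n` to `n + 1` the signs gain `(-1)(-1)^{n+1}(-1)^n = 1`, and the remaining new factors
    -- are those of `h3`.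
    calc _ = ((-1 : ℝ) ^ n * (Real.sqrt 2)⁻¹ ^ n * ((-1) ^ (n * (n + 1) / 2) *
          (Real.sqrt 2 * Real.sqrt Real.pi)⁻¹ ^ n) * topCoeff n * 2 ^ n) *
          (((-1 : ℝ) ^ n) * (-1) ^ n) *
          ((Real.sqrt 2)⁻¹ * (Real.sqrt 2 * Real.sqrt Real.pi)⁻¹ * Real.sqrt Real.pi * 2) := by
          ring
      _ = 1 := by rw [ih, hs, h3]; norm_num

/-- Adding twice the negative part to `Q` turns it into the Siegel majorant. -/
lemma exp_form_mul_exp (u : V p q) :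
    Real.exp (-Real.pi * form u u) *
      Real.exp (-(2 * Real.pi * fiberInner p (pr p q u) (pr p q u))) = gaussian p q u := by
  rw [← Real.exp_add]
  change _ = Real.exp (-Real.pi * siegelMajorant u)
  congr 1
  rw [fiberInner_eq_sum, form, siegelMajorant, Fintype.sum_sum_type]
  simp only [pr, LinearMap.coe_mk, AddHom.coe_mk, pow_two]
  ring

lemma kudlaMillson_eq (b : Fin q → Z q)
    (hb : ∀ i j, fiberInner p (b i) (b j) = if i = j then 1 else 0) (v : V p q) :
    kudlaMillson v = ((-1 : ℝ) ^ q * Matrix.det (Matrix.of b) *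
        ((2 : ℝ) ^ (-(q : ℝ) / 2) * Real.exp (-Real.pi * form v v))) •
      pullbackSection (sectionV v) (mathaiQuillen p q b) := by
  funext g
  -- Invariance of `Q` lets the constant `Q(v,v)` be computed at `u = g⁻¹ v`, where the rest of the
  -- formula lives.
  rw [Pi.smul_apply, pullbackSection_mathaiQuillen, kudlaMillson, smul_smul, ← form_act g⁻¹ v v]
  set u := act g⁻¹ v
  have h : (-1 : ℝ) ^ q * (Matrix.of b).det * ((2 : ℝ) ^ (-(q : ℝ) / 2) *
      Real.exp (-Real.pi * form u u)) * (mqConst q *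
      Real.exp (-(2 * Real.pi * fiberInner p (pr p q u) (pr p q u)))) =
      ((-1 : ℝ) ^ q * (Matrix.of b).det * (2 : ℝ) ^ (-(q : ℝ) / 2) * mqConst q) *
        gaussian p q u := by
    rw [← exp_form_mul_exp]; ring
  rw [h, ← smul_smul, gaussian_smul_berezinForm_nilExp, smul_smul]
  have h' : (-1 : ℝ) ^ q * (Matrix.of b).det * (2 : ℝ) ^ (-(q : ℝ) / 2) * mqConst q *
      (topCoeff q * (Matrix.of b).det * 2 ^ q) = 1 := by
    calc _ = ((-1 : ℝ) ^ q * (2 : ℝ) ^ (-(q : ℝ) / 2) * mqConst q * topCoeff q * 2 ^ q) *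
          ((Matrix.of b).det * (Matrix.of b).det) := by ring
      _ = 1 := by rw [const_identity, det_mul_self b hb, one_mul]
  rw [h', one_smul]

end TopDegree

end

end KudlaMillson

theorem theorem4p1 (p q : ℕ)
    (b : Fin q → KudlaMillson.Z q)
    (hb : ∀ i j, KudlaMillson.fiberInner p (b i) (b j) = if i = j then 1 else 0)
    (Γ : Subgroup (KudlaMillson.Gplus p q)) (v : KudlaMillson.V p q) :
    KudlaMillson.IsFormOnE (KudlaMillson.stabilizerIn Γ v) q (KudlaMillson.mathaiQuillen p q b) ∧
    KudlaMillson.IsFormOnD (KudlaMillson.stabilizerIn Γ v) q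
      (KudlaMillson.pullbackSection (KudlaMillson.sectionV v)
        (KudlaMillson.mathaiQuillen p q b)) ∧
    KudlaMillson.IsFormOnD (KudlaMillson.stabilizerIn Γ v) q (KudlaMillson.kudlaMillson v) ∧
    KudlaMillson.kudlaMillson v =
      ((-1 : ℝ) ^ q * Matrix.det (Matrix.of b) *
          ((2 : ℝ) ^ (-(q : ℝ) / 2) * Real.exp (-Real.pi * KudlaMillson.form v v))) •
        KudlaMillson.pullbackSection (KudlaMillson.sectionV v)
          (KudlaMillson.mathaiQuillen p q b) := by
  have h := KudlaMillson.isFormOnD_pullbackSection b Γ v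
  have e := KudlaMillson.kudlaMillson_eq b hb v
  exact ⟨KudlaMillson.isFormOnE_mathaiQuillen b _, h, e ▸ h.const_smul _, e⟩
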